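/- Let $E$ be a finite set. An implication $A\to B$ on $E$ is a pair of subsets $A,B\subseteq E$; it is proper if $B\neq\emptyset$ and improper if $B=\emptyset$. For a family $\Sigma$ of implications on $E$, let $\mathcal F(\Sigma)\subseteq 2^E$ be the $\cap$-closed family, ordered by inclusion, of all $X\subseteq E$ such that $A\subseteq X$ implies $B\subseteq X$ for every proper $(A\to B)\in\Sigma$, and $A\not\subseteq X$ for every improper $(A\to\emptyset)\in\Sigma$. Put $s(\Sigma)=\sum_{(A\to B)\in\Sigma}(|A|+|B|)$. A (nonempty) $\wedge$-semilattice $L$ is called modular if every principal ideal $\{p\in L\mid p\le x\}$ is a modular lattice and, for all $x,y,z\in L$, the join $x\vee y\vee z$ exists whenever $x\vee y$, $y\vee z$ and $z\vee x$ exist. **Theorem.** There is a polynomial-time algorithm that, given a finite set $E$ and a family $\Sigma$ of implications on $E$, decides whether $\mathcal F(\Sigma)$ is a modular semilattice. Precisely: there are a single program for a deterministic unit-cost random access machine (with indirect addressing, comparison, addition and truncated subtraction on natural numbers) and a polynomial $p$ such that, for every $n\ge 0$, every family $\Sigma$ of implications on $E=\{0,\dots,n-1\}$, and every input word that consists of $n$,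 $|\Sigma|$ and, for each implication of $\Sigma$ in some order, a listing of its premise and a listing of its conclusion (each preceded by its length), the program halts after at most $p(|E|+|\Sigma|+s(\Sigma))$ steps, with output $1$ if $\mathcal F(\Sigma)$ is a modular semilattice and with output $0$ otherwise. -/

import Mathlib

/-! ### Random access machines with a step count

A program works on scalar registers `reg 0, reg 1, …` and on arrays `arr 0, arr 1, …` of unbounded
length, all holding natural numbers.  Arrays are accessed by indirect addressing, and the only
arithmetic is addition and truncated subtraction, so that unit cost is polynomially related to
Turing machine time.  (A program text mentions only finitely many registers and arrays.) -/

namespace RAM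

/-- The memory of the machine. -/
structure State where
  reg : ℕ → ℕ
  arr : ℕ → ℕ → ℕ

/-- Write `v` into register `r`. -/
def State.setReg (σ : State) (r v : ℕ) : State :=
  { σ with reg := Function.update σ.reg r v }

/-- Write `v` into cell `i` of array `a`. -/
def State.setArr (σ : State) (a i v : ℕ) : State :=
  { σ with arr := Function.update σ.arr a (Function.update (σ.arr a) i v) }

/-- Programs. The arguments `r s t` name registers, `a` names an array, `k` is a literal. -/
inductive Program : Type
  /-- `reg r := k` -/
  | const (r k : ℕ) : Program
  /-- `reg r := reg s` -/
  | copy (r s : ℕ) : Program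
  /-- `reg r := reg s + reg t` -/
  | add (r s t : ℕ) : Program
  /-- `reg r := reg s - reg t`, truncated at `0` -/
  | sub (r s t : ℕ) : Program
  /-- `reg r := arr a [reg s]` -/
  | load (r a s : ℕ) : Program
  /-- `arr a [reg s] := reg t` -/
  | store (a s t : ℕ) : Program
  /-- first `P`, then `Q` -/
  | seq (P Q : Program) : Program
  /-- if `reg r < reg s` then `P` else `Q` -/
  | ifLt (r s : ℕ) (P Q : Program) : Program
  /-- while `reg r < reg s` do `P` -/
  | whileLt (r s : ℕ) (P : Program) : Program

/-- `Exec P σ t τ`: started in the state `σ`, the program `P` halts in the state `τ` after exactly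
`t` steps. Every assignment and every evaluation of a test is one step. -/
inductive Exec : Program → State → ℕ → State → Prop
  | const (σ : State) (r k : ℕ) :
      Exec (.const r k) σ 1 (σ.setReg r k)
  | copy (σ : State) (r s : ℕ) :
      Exec (.copy r s) σ 1 (σ.setReg r (σ.reg s))
  | add (σ : State) (r s t : ℕ) :
      Exec (.add r s t) σ 1 (σ.setReg r (σ.reg s + σ.reg t))
  | sub (σ : State) (r s t : ℕ) :
      Exec (.sub r s t) σ 1 (σ.setReg r (σ.reg s - σ.reg t))
  | load (σ : State) (r a s : ℕ) :
      Exec (.load r a s) σ 1 (σ.setReg r (σ.arr a (σ.reg s)))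
  | store (σ : State) (a s t : ℕ) :
      Exec (.store a s t) σ 1 (σ.setArr a (σ.reg s) (σ.reg t))
  | seq {P Q : Program} {σ τ υ : State} {m n : ℕ} :
      Exec P σ m τ → Exec Q τ n υ → Exec (.seq P Q) σ (m + n) υ
  | ifLt_true {r s : ℕ} {P Q : Program} {σ τ : State} {m : ℕ} :
      σ.reg r < σ.reg s → Exec P σ m τ → Exec (.ifLt r s P Q) σ (m + 1) τ
  | ifLt_false {r s : ℕ} {P Q : Program} {σ τ : State} {m : ℕ} :
      ¬ σ.reg r < σ.reg s → Exec Q σ m τ → Exec (.ifLt r s P Q) σ (m + 1) τ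
  | whileLt_true {r s : ℕ} {P : Program} {σ τ υ : State} {m n : ℕ} :
      σ.reg r < σ.reg s → Exec P σ m τ → Exec (.whileLt r s P) τ n υ →
        Exec (.whileLt r s P) σ (m + n + 1) υ
  | whileLt_false {r s : ℕ} {P : Program} {σ : State} :
      ¬ σ.reg r < σ.reg s → Exec (.whileLt r s P) σ 1 σ

/-- The machine is deterministic: a halting run has one step count and one final state. -/
theorem Exec.unique {P : Program} {σ τ : State} {m : ℕ} (h : Exec P σ m τ) :
    ∀ {n : ℕ} {υ : State}, Exec P σ n υ → m = n ∧ τ = υ := by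
  induction h with
  | seq _ _ ih₁ ih₂ =>
    intro n υ h
    cases h with
    | seq h₁ h₂ =>
      obtain ⟨rfl, rfl⟩ := ih₁ h₁
      obtain ⟨rfl, rfl⟩ := ih₂ h₂
      exact ⟨rfl, rfl⟩
  | ifLt_true hc _ ih =>
    intro n υ h
    cases h with
    | ifLt_true _ h₁ => obtain ⟨rfl, rfl⟩ := ih h₁; exact ⟨rfl, rfl⟩
    | ifLt_false hn _ => exact absurd hc hn
  | ifLt_false hc _ ih =>
    intro n υ h
    cases h with
    | ifLt_true hn _ => exact absurd hn hc
    | ifLt_false _ h₁ => obtain ⟨rfl, rfl⟩ := ih h₁; exact ⟨rfl, rfl⟩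
  | whileLt_true hc _ _ ih₁ ih₂ =>
    intro n υ h
    cases h with
    | whileLt_true _ h₁ h₂ =>
      obtain ⟨rfl, rfl⟩ := ih₁ h₁
      obtain ⟨rfl, rfl⟩ := ih₂ h₂
      exact ⟨rfl, rfl⟩
    | whileLt_false hn => exact absurd hc hn
  | whileLt_false hc =>
    intro n υ h
    cases h with
    | whileLt_true hn _ _ => exact absurd hn hc
    | whileLt_false _ => exact ⟨rfl, rfl⟩
  | _ => intro n υ h; cases h; exact ⟨rfl, rfl⟩

/-- The state in which the machine starts on the input word `w`: the word is in array `0`, and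
all other cells and registers are `0`. -/
def inputState (w : List ℕ) : State where
  reg := fun _ => 0
  arr := fun a i => if a = 0 then w.getD i 0 else 0

end RAM

/-! ### Modular semilattices -/

/-- The partial order `P` is a modular lattice. -/
def IsModularLatticeOrder (P : Type*) [inst : PartialOrder P] : Prop :=
  ∃ L : Lattice P, L.toPartialOrder = inst ∧ @IsModularLattice P L

/-- The partial order `P` is a (nonempty, meet-) semilattice that is modular: every principal
ideal is a modular lattice, and `x ∨ y ∨ z` exists whenever `x ∨ y`, `y ∨ z` and `z ∨ x` exist. -/
structure IsModularSemilattice (P : Type*) [PartialOrder P] : Prop where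
  nonempty : Nonempty P
  exists_meet : ∀ x y : P, ∃ m, IsGLB {x, y} m
  principalIdeal_modular : ∀ x : P, IsModularLatticeOrder (Set.Iic x)
  exists_join : ∀ x y z : P, (∃ j, IsLUB {x, y} j) → (∃ j, IsLUB {y, z} j) →
    (∃ j, IsLUB {z, x} j) → ∃ j, IsLUB {x, y, z} j

/-! ### Implications -/

/-- An implication `A → B` on `E`, as the pair of its premise `A` and its conclusion `B`.
It is proper if `B` is nonempty and improper if `B` is empty. -/
abbrev Implication (E : Type*) := Finset E × Finset E

/-- The family of all `X` that satisfy `A ⊆ X → B ⊆ X` for every proper implication `A → B` in `S`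
and `¬ A ⊆ X` for every improper implication `A → ∅` in `S`. It is ordered by inclusion. -/
def closedFamily {E : Type*} (S : Finset (Implication E)) : Set (Finset E) :=
  {X | ∀ I ∈ S, (I.2.Nonempty → I.1 ⊆ X → I.2 ⊆ X) ∧ (I.2 = ∅ → ¬ I.1 ⊆ X)}

/-- The family is closed under intersection. -/
theorem inter_mem_closedFamily {E : Type*} [DecidableEq E] {S : Finset (Implication E)}
    {X Y : Finset E} (hX : X ∈ closedFamily S) (hY : Y ∈ closedFamily S) :
    X ∩ Y ∈ closedFamily S := fun I hI =>
  ⟨fun hB hA => Finset.subset_inter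
      ((hX I hI).1 hB (hA.trans Finset.inter_subset_left))
      ((hY I hI).1 hB (hA.trans Finset.inter_subset_right)),
    fun hB hA => (hX I hI).2 hB (hA.trans Finset.inter_subset_left)⟩

/-- The size `∑ (|A| + |B|)`, over all `A → B` in `S`. -/
def implicationSize {E : Type*} (S : Finset (Implication E)) : ℕ :=
  ∑ I ∈ S, (I.1.card + I.2.card)

/-! ### Input words -/

/-- A list of elements of `{0, …, n - 1}`, written with its length in front. -/
def encodeElements {n : ℕ} (l : List (Fin n)) : List ℕ :=
  l.length :: l.map Fin.val

/-- A list of implications on `{0, …, n - 1}`, each given by a listing of its premise and a listing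
of its conclusion: first `n`, then the number of implications, then the implications one by one. -/
def encodeSystem {n : ℕ} (L : List (List (Fin n) × List (Fin n))) : List ℕ :=
  n :: L.length :: L.flatMap fun I => encodeElements I.1 ++ encodeElements I.2

/-- The word `w` is an input word for the family `S`: it lists every implication in `S` once (in any
order), and it lists every element of its premise and of its conclusion once (in any order). -/
def IsInputWord {n : ℕ} (w : List ℕ) (S : Finset (Implication (Fin n))) : Prop :=
  ∃ L : List (List (Fin n) × List (Fin n)),
    (∀ I ∈ L, I.1.Nodup ∧ I.2.Nodup) ∧
    (L.map fun I => (I.1.toFinset, I.2.toFinset)).Nodup ∧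
    (∀ J, J ∈ S ↔ J ∈ L.map fun I => (I.1.toFinset, I.2.toFinset)) ∧
    w = encodeSystem L

/-!
An element `b` for inconsistency is added to the ground set: an improper implication `A → ∅` becomes
`A → b`, and everything follows from `b`. The members of the family are then the closed sets without
`b` of a closure operator `cl` on a finite set (`RAM.isModularSemilattice_closedFamily_iff`), and
elements are consistent if `b` is not in their closure.

Modularity is tested on the set `J` of the elements with join irreducible closure (`joinIrr`). In a
modular lattice, an element of `J` below `x ∨ y`, but below neither `x` nor `y`, is in `cl {p, q}`
for some `p ≤ x` and `q ≤ y` in `J` (`ModularClosure.exists_pair`). So closed sets are determined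
by the closures of pairs, which is a property that can be tested implication by implication; and the
decomposition for closures of four elements, together with the modular law for triples in `J`, is
also testable. Conversely, these finitely many conditions (`LocallyModular`) suffice: the union of
all `cl {p, q}` with `p ≤ x` and `q ≤ y` is closed under closures of pairs, hence closed, so it is
the join of `x` and `y`, and the modular law follows from its instances in `J`. Consistency of
pairwise consistent quadruples of `J` gives the existence of triple joins in the same way.

The conditions are sentences of first-order logic over `{0, …, N - 1}`, with `N = n + |Σ| + 2`,
about relations that are given by least fixed points; both fixed points are reached after `N`
stages. A formula is evaluated by nested loops of length `N`, and a relation is tabulated in an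
array whose index is a number in base `N`, where the stage of a fixed point is one more argument
(`RAM.runs_code`, `RAM.runs_table`). As every loop has length `N`, the number of steps is bounded by
a polynomial in `N` that can be read off the program (`RAM.Program.cost`).
-/

namespace RAM

/-! ### Runs with a syntactic time bound -/

/-- A bound for the number of steps of a program, as a polynomial in a number `N` such that no
loop is run more than `N` times. It is read off the text of the program. -/
noncomputable def Program.cost : Program → Polynomial ℕ
  | .const _ _ => 1
  | .copy _ _ => 1
  | .add _ _ _ => 1
  | .sub _ _ _ => 1
  | .load _ _ _ => 1
  | .store _ _ _ => 1
  | .seq P Q => P.cost + Q.cost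
  | .ifLt _ _ P Q => P.cost + Q.cost + 1
  | .whileLt _ _ P => Polynomial.X * (P.cost + 1) + 1

/-- Started in `σ`, the program `P` halts within `P.cost.eval N` steps, in a state that
satisfies `Q`: a weakest precondition that keeps account of the time. -/
def Runs (N : ℕ) (P : Program) (σ : State) (Q : State → Prop) : Prop :=
  ∃ t τ, Exec P σ t τ ∧ t ≤ P.cost.eval N ∧ Q τ

section
variable {N : ℕ} {σ : State} {P P' : Program} {Q Q' : State → Prop}

theorem Runs.mono (h : Runs N P σ Q) (hQ : ∀ τ, Q τ → Q' τ) : Runs N P σ Q' := by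
  obtain ⟨t, τ, h1, h2, h3⟩ := h
  exact ⟨t, τ, h1, h2, hQ τ h3⟩

theorem Runs.const {r k : ℕ} (h : Q (σ.setReg r k)) : Runs N (.const r k) σ Q :=
  ⟨_, _, .const σ r k, by simp [Program.cost], h⟩

theorem Runs.copy {r s : ℕ} (h : Q (σ.setReg r (σ.reg s))) : Runs N (.copy r s) σ Q :=
  ⟨_, _, .copy σ r s, by simp [Program.cost], h⟩

theorem Runs.add {r s t : ℕ} (h : Q (σ.setReg r (σ.reg s + σ.reg t))) :
    Runs N (.add r s t) σ Q :=
  ⟨_, _, .add σ r s t, by simp [Program.cost], h⟩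

theorem Runs.sub {r s t : ℕ} (h : Q (σ.setReg r (σ.reg s - σ.reg t))) :
    Runs N (.sub r s t) σ Q :=
  ⟨_, _, .sub σ r s t, by simp [Program.cost], h⟩

theorem Runs.load {r a s : ℕ} (h : Q (σ.setReg r (σ.arr a (σ.reg s)))) :
    Runs N (.load r a s) σ Q :=
  ⟨_, _, .load σ r a s, by simp [Program.cost], h⟩

theorem Runs.store {a s t : ℕ} (h : Q (σ.setArr a (σ.reg s) (σ.reg t))) :
    Runs N (.store a s t) σ Q :=
  ⟨_, _, .store σ a s t, by simp [Program.cost], h⟩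

theorem Runs.seq (h : Runs N P σ fun τ => Runs N P' τ Q) : Runs N (.seq P P') σ Q := by
  obtain ⟨t, τ, h1, h2, u, υ, h3, h4, h5⟩ := h
  refine ⟨_, _, .seq h1 h3, ?_, h5⟩
  simp only [Program.cost, Polynomial.eval_add]
  omega

theorem Runs.ifLt {r s : ℕ} (h1 : σ.reg r < σ.reg s → Runs N P σ Q)
    (h2 : ¬ σ.reg r < σ.reg s → Runs N P' σ Q) : Runs N (.ifLt r s P P') σ Q := by
  by_cases h : σ.reg r < σ.reg s
  · obtain ⟨t, τ, h3, h4, h5⟩ := h1 h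
    refine ⟨_, _, .ifLt_true h h3, ?_, h5⟩
    simp only [Program.cost, Polynomial.eval_add, Polynomial.eval_one]
    omega
  · obtain ⟨t, τ, h3, h4, h5⟩ := h2 h
    refine ⟨_, _, .ifLt_false h h3, ?_, h5⟩
    simp only [Program.cost, Polynomial.eval_add, Polynomial.eval_one]
    omega

theorem Runs.whileLt {r s : ℕ} (I : ℕ → State → Prop) (h0 : I 0 σ)
    (hstep : ∀ k < N, ∀ τ, I k τ → τ.reg r < τ.reg s ∧ Runs N P τ (I (k + 1)))
    (hend : ∀ τ, I N τ → ¬ τ.reg r < τ.reg s) : Runs N (.whileLt r s P) σ (I N) := by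
  have key : ∀ j k τ, k + j = N → I k τ → ∃ t υ, Exec (.whileLt r s P) τ t υ ∧
      t ≤ j * (P.cost.eval N + 1) + 1 ∧ I N υ := by
    intro j
    induction j with
    | zero =>
      intro k τ hk hI
      obtain rfl : k = N := by omega
      exact ⟨1, τ, .whileLt_false (hend τ hI), by omega, hI⟩
    | succ j ih =>
      intro k τ hk hI
      obtain ⟨hlt, t, υ, h1, h2, h3⟩ := hstep k (by omega) τ hI
      obtain ⟨t', φ, h4, h5, h6⟩ := ih (k + 1) υ (by omega) h3
      refine ⟨_, _, .whileLt_true hlt h1 h4, ?_, h6⟩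
      rw [Nat.succ_mul]
      omega
  obtain ⟨t, υ, h1, h2, h3⟩ := key N 0 σ (by omega) h0
  exact ⟨t, υ, h1, by simpa [Program.cost] using h2, h3⟩

end

@[simp] theorem setReg_reg (σ : State) (r v s : ℕ) :
    (σ.setReg r v).reg s = if s = r then v else σ.reg s := by
  simp [State.setReg, Function.update_apply]

@[simp] theorem setReg_arr (σ : State) (r v : ℕ) : (σ.setReg r v).arr = σ.arr := rfl

@[simp] theorem setArr_reg (σ : State) (a i v : ℕ) : (σ.setArr a i v).reg = σ.reg := rfl

theorem setArr_arr (σ : State) (a i v b j : ℕ) :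
    (σ.setArr a i v).arr b j = if b = a ∧ j = i then v else σ.arr b j := by
  by_cases h : b = a
  · subst h; simp [State.setArr, Function.update_apply]
  · simp [State.setArr, h]

/-- Register `1` holds the common bound `N` of all loops, and the registers `2` and `3` hold the
constants `0` and `1`. -/
structure Ready (N : ℕ) (σ : State) : Prop where
  bound : σ.reg 1 = N
  zero : σ.reg 2 = 0
  one : σ.reg 3 = 1

theorem Ready.of_eq {N : ℕ} {σ τ : State} (h : Ready N σ) (h' : ∀ r < 4, τ.reg r = σ.reg r) :
    Ready N τ :=
  ⟨by rw [h' 1 (by norm_num), h.bound], by rw [h' 2 (by norm_num), h.zero],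
    by rw [h' 3 (by norm_num), h.one]⟩

theorem Ready.setReg {N : ℕ} {σ : State} (h : Ready N σ) {r : ℕ} (hr : 4 ≤ r) (v : ℕ) :
    Ready N (σ.setReg r v) :=
  h.of_eq fun s hs => by rw [setReg_reg, if_neg (by omega)]

/-- Run `P` with the values `0, 1, …, N - 1` in register `i`. -/
def forN (i : ℕ) (P : Program) : Program :=
  .seq (.const i 0) (.whileLt i 1 (.seq P (.add i i 3)))

theorem Runs.forN {N : ℕ} {σ : State} {P : Program} {i : ℕ} (hi : 4 ≤ i) (hσ : Ready N σ)
    (I : ℕ → State → Prop) (h0 : I 0 (σ.setReg i 0))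
    (hstep : ∀ k < N, ∀ τ, I k τ → Ready N τ → τ.reg i = k → Runs N P τ fun υ =>
      Ready N υ ∧ υ.reg i = k ∧ I (k + 1) (υ.setReg i (k + 1))) :
    Runs N (forN i P) σ fun τ => I N τ ∧ Ready N τ := by
  refine .seq (.const ?_)
  refine (Runs.whileLt (fun k τ => I k τ ∧ Ready N τ ∧ τ.reg i = k)
    ⟨h0, hσ.setReg hi 0, by simp⟩ ?_ ?_).mono fun τ h => ⟨h.1, h.2.1⟩
  · rintro k hk τ ⟨hI, hR, hik⟩
    refine ⟨by rw [hik, hR.bound]; exact hk, .seq ((hstep k hk τ hI hR hik).mono ?_)⟩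
    rintro υ ⟨hR', hik', hI'⟩
    refine .add ?_
    rw [hik', hR'.one]
    exact ⟨hI', hR'.setReg hi _, by simp⟩
  · rintro τ ⟨-, hR, hik⟩
    rw [hik, hR.bound]
    exact lt_irrefl N

/-! ### Evaluating formulas with bounded quantifiers -/

/-- The register that holds variable `x` of a formula. The registers `4`, `5` and `6` are left for
scratch work. -/
def var (x : ℕ) : ℕ := 7 + 2 * x

/-- The register that receives the truth value of a subformula at depth `k`. -/
def tmp (k : ℕ) : ℕ := 8 + 2 * k

/-- Compute in register `4` the number with the digits `xs` (variables, the least significant one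
first) in base `N`. The product by `N` is a repeated addition. -/
def index : List ℕ → Program
  | [] => .const 4 0
  | x :: xs => .seq (index xs) (.seq (.copy 5 4) (.seq (.const 4 0)
      (.seq (forN 6 (.add 4 4 5)) (.add 4 4 (var x)))))

theorem runs_index {N : ℕ} {σ : State} (hσ : Ready N σ) (xs : List ℕ) :
    Runs N (index xs) σ fun τ => τ.arr = σ.arr ∧
      τ.reg 4 = Nat.ofDigits N (xs.map fun x => σ.reg (var x)) ∧
      ∀ r, r ≠ 4 → r ≠ 5 → r ≠ 6 → τ.reg r = σ.reg r := by
  induction xs with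
  | nil => exact .const ⟨rfl, by simp, fun r h4 _ _ => by simp [h4]⟩
  | cons x xs ih =>
    refine .seq (ih.mono ?_)
    rintro τ ⟨ha, h4, hr⟩
    refine .seq (.copy (.seq (.const (.seq ?_))))
    refine (Runs.forN (by norm_num) ?_ (fun k υ => υ.arr = σ.arr ∧ υ.reg 4 = k * τ.reg 4 ∧
      υ.reg 5 = τ.reg 4 ∧ ∀ r, r ≠ 4 → r ≠ 5 → r ≠ 6 → υ.reg r = σ.reg r) ?_ ?_).mono ?_
    · refine ((hσ.of_eq fun r h => ?_).setReg le_rfl _)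
      rw [setReg_reg, if_neg (by omega), hr r (by omega) (by omega) (by omega)]
    · refine ⟨ha, by simp, by simp, fun r h4 h5 h6 => ?_⟩
      simp [h4, h5, h6, hr]
    · rintro k - υ ⟨h1, h2, h3, h5⟩ hR hk
      refine .add ⟨hR.setReg le_rfl _, by simpa using hk, h1, ?_, by simpa using h3, ?_⟩
      · simp [h2, h3, Nat.succ_mul]
      · intro r h4 h5' h6
        simp [h4, h6, h5 r h4 h5' h6]
    · rintro υ ⟨⟨h1, h2, -, h5⟩, -⟩
      refine .add ⟨h1, ?_, fun r h4 h5' h6 => by simp [h4, h5 r h4 h5' h6]⟩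
      have hv : υ.reg (var x) = σ.reg (var x) :=
        h5 _ (by simp [var]; omega) (by simp [var]; omega) (by simp [var]; omega)
      simp [h2, h4, hv, Nat.ofDigits_cons, add_comm]

/-- First-order formulas over the ordered set `{0, …, N - 1}`, with relations stored in arrays. -/
inductive Form : Type
  /-- `x < y` -/
  | lt (x y : ℕ) : Form
  /-- the entry of the array `a` at the index with the digits `xs` is not `0` -/
  | rel (a : ℕ) (xs : List ℕ) : Form
  | not (φ : Form) : Form
  | and (φ ψ : Form) : Form
  /-- there is a value of the variable `x` such that `φ` -/
  | ex (x : ℕ) (φ : Form) : Form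

namespace Form

end Form

/-- The array index of the tuple `xs`: the number with these digits in base `N`. -/
def cell {N : ℕ} (xs : List (Fin N)) : ℕ := Nat.ofDigits N (xs.map Fin.val)

theorem cell_injective {N : ℕ} (hN : 1 < N) {xs ys : List (Fin N)} (h : xs.length = ys.length)
    (hc : cell xs = cell ys) : xs = ys := by
  refine List.map_injective_iff.2 Fin.val_injective ?_
  refine Nat.ofDigits_inj_of_len_eq hN (by simpa using h) ?_ ?_ hc <;>
  · intro l hl
    obtain ⟨x, -, rfl⟩ := List.mem_map.1 hl
    exact x.2

namespace Form

/-- The truth of a formula in the array contents `A`, under the assignment `ρ`. -/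
def Sat {N : ℕ} (A : ℕ → ℕ → ℕ) : (ℕ → Fin N) → Form → Prop
  | ρ, lt x y => ρ x < ρ y
  | ρ, rel a xs => 0 < A a (cell (xs.map ρ))
  | ρ, not φ => ¬ Sat A ρ φ
  | ρ, and φ ψ => Sat A ρ φ ∧ Sat A ρ ψ
  | ρ, ex x φ => ∃ i, Sat A (Function.update ρ x i) φ

/-- The free variables of the formula are below `d`, and the quantifiers bind the variables
`d, d + 1, …` according to their nesting, so that no variable is reused in its own scope. -/
def closedBelow : ℕ → Form → Bool
  | d, lt x y => x < d && y < d
  | d, rel _ xs => xs.all fun x => x < d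
  | d, not φ => φ.closedBelow d
  | d, and φ ψ => φ.closedBelow d && ψ.closedBelow d
  | d, ex x φ => x = d && φ.closedBelow (x + 1)

/-- Compute the truth value of a formula in the register `tmp k`. -/
def code : ℕ → Form → Program
  | k, lt x y => .ifLt (var x) (var y) (.const (tmp k) 1) (.const (tmp k) 0)
  | k, rel a xs => .seq (index xs) (.seq (.load 4 a 4)
      (.ifLt 2 4 (.const (tmp k) 1) (.const (tmp k) 0)))
  | k, not φ => .seq (φ.code k) (.sub (tmp k) 3 (tmp k))
  | k, and φ ψ => .seq (φ.code k) (.seq (ψ.code (k + 1))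
      (.ifLt 2 (tmp k) (.copy (tmp k) (tmp (k + 1))) (.const (tmp k) 0)))
  | k, ex x φ => .seq (.const (tmp k) 0) (forN (var x) (.seq (φ.code (k + 1))
      (.ifLt 2 (tmp (k + 1)) (.const (tmp k) 1) (.copy (tmp k) (tmp k)))))

end Form

/-- The registers that the evaluation of a formula at depth `k` must not change, if the variables
below `d` are in use. -/
def Kept (d k r : ℕ) : Prop := r < 4 ∨ (∃ x < d, r = var x) ∨ ∃ j < k, r = tmp j

theorem Kept.mono {d d' k k' r : ℕ} (h : Kept d k r) (hd : d ≤ d') (hk : k ≤ k') :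
    Kept d' k' r := by
  rcases h with h | ⟨x, hx, h⟩ | ⟨j, hj, h⟩
  · exact .inl h
  · exact .inr (.inl ⟨x, by omega, h⟩)
  · exact .inr (.inr ⟨j, by omega, h⟩)

theorem Kept.ne_tmp {d k r : ℕ} (h : Kept d k r) : r ≠ tmp k := by
  rcases h with h | ⟨x, hx, h⟩ | ⟨j, hj, h⟩ <;> simp only [tmp, var] at * <;> omega

theorem Kept.ne_var {d k r x : ℕ} (h : Kept d k r) (hx : d ≤ x) : r ≠ var x := by
  rcases h with h | ⟨x, hx, h⟩ | ⟨j, hj, h⟩ <;> simp only [tmp, var] at * <;> omega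

theorem Kept.ne_scratch {d k r s : ℕ} (h : Kept d k r) (h4 : 4 ≤ s) (h6 : s ≤ 6) : r ≠ s := by
  rcases h with h | ⟨x, hx, rfl⟩ | ⟨j, hj, rfl⟩
  · omega
  · simp only [var]; omega
  · simp only [tmp]; omega

theorem Kept.var {d k x : ℕ} (h : x < d) : Kept d k (var x) := .inr (.inl ⟨x, h, rfl⟩)

theorem Kept.tmp {d k j : ℕ} (h : j < k) : Kept d k (tmp j) := .inr (.inr ⟨j, h, rfl⟩)

theorem four_le_var (x : ℕ) : 4 ≤ var x := by simp only [var]; omega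

theorem four_le_tmp (k : ℕ) : 4 ≤ tmp k := by simp only [tmp]; omega

open Classical in
/-- The evaluation of a formula is correct, if the registers of the variables below `d` have the
values that `ρ` assigns to them; the values of `ρ` from `d` on do not matter. -/
theorem runs_code {N : ℕ} (φ : Form) : ∀ {d k : ℕ} {σ : State} {ρ : ℕ → Fin N},
    φ.closedBelow d → Ready N σ → (∀ x < d, σ.reg (var x) = ρ x) →
    Runs N (φ.code k) σ fun τ => τ.arr = σ.arr ∧
      τ.reg (tmp k) = (if φ.Sat σ.arr ρ then 1 else 0) ∧
      ∀ r, Kept d k r → τ.reg r = σ.reg r := by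
  induction φ with
  | lt x y =>
    intro d k σ ρ hs hσ hρ
    simp only [Form.closedBelow, Bool.and_eq_true, decide_eq_true_eq] at hs
    have hxy : σ.reg (var x) < σ.reg (var y) ↔ ρ x < ρ y := by
      rw [hρ x hs.1, hρ y hs.2, Fin.lt_def]
    refine .ifLt (fun h => .const ?_) (fun h => .const ?_)
    · exact ⟨rfl, by simp [Form.Sat, hxy.1 h], fun r hr => by simp [hr.ne_tmp]⟩
    · exact ⟨rfl, by simp [Form.Sat, mt hxy.2 h], fun r hr => by simp [hr.ne_tmp]⟩
  | rel a xs =>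
    intro d k σ ρ hs hσ hρ
    simp only [Form.closedBelow, List.all_eq_true, decide_eq_true_eq] at hs
    refine .seq ((runs_index hσ xs).mono ?_)
    rintro τ ⟨h1, h2, h3⟩
    have hm : (xs.map fun x => σ.reg (var x)) = (xs.map ρ).map Fin.val := by
      rw [List.map_map]
      exact List.map_congr_left fun x hx => hρ x (hs x hx)
    have hsat : (Form.rel a xs).Sat σ.arr ρ ↔ 0 < σ.arr a (cell (xs.map ρ)) := Iff.rfl
    have hz : τ.reg 2 = 0 := by rw [h3 2 (by omega) (by omega) (by omega), hσ.zero]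
    rw [hm] at h2
    change _ = cell _ at h2
    have hk : ∀ r, Kept d k r → τ.reg r = σ.reg r := fun r hr =>
      h3 r (hr.ne_scratch (by omega) (by omega)) (hr.ne_scratch (by omega) (by omega))
        (hr.ne_scratch (by omega) (by omega))
    refine .seq (.load (.ifLt (fun h => .const ?_) (fun h => .const ?_)))
    · refine ⟨h1, ?_, fun r hr => by
        simp [hr.ne_tmp, hr.ne_scratch (s := 4) (by omega) (by omega), hk r hr]⟩
      simp only [setReg_reg, if_true, h2, hz, h1] at h ⊢
      rw [if_pos (hsat.2 (by simpa using h))]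
    · refine ⟨h1, ?_, fun r hr => by
        simp [hr.ne_tmp, hr.ne_scratch (s := 4) (by omega) (by omega), hk r hr]⟩
      simp only [setReg_reg, if_true, h2, hz, h1] at h ⊢
      rw [if_neg (mt hsat.1 (by simpa using h))]
  | not φ ih =>
    intro d k σ ρ hs hσ hρ
    refine .seq ((ih (k := k) hs hσ hρ).mono ?_)
    rintro τ ⟨h1, h2, h3⟩
    refine .sub ⟨h1, ?_, fun r hr => by simp [hr.ne_tmp, h3 r hr]⟩
    have : τ.reg 3 = 1 := by rw [h3 3 (.inl (by omega)), hσ.one]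
    by_cases h : φ.Sat σ.arr ρ <;> simp [Form.Sat, h, h2, this]
  | and φ ψ ih1 ih2 =>
    intro d k σ ρ hs hσ hρ
    simp only [Form.closedBelow, Bool.and_eq_true] at hs
    refine .seq ((ih1 (k := k) hs.1 hσ hρ).mono ?_)
    rintro τ ⟨h1, h2, h3⟩
    have hτ : Ready N τ := hσ.of_eq fun r hr => h3 r (.inl hr)
    have hρ' : ∀ x < d, τ.reg (var x) = ρ x := fun x hx => by rw [h3 _ (.var hx), hρ x hx]
    refine .seq ((ih2 (k := k + 1) hs.2 hτ hρ').mono ?_)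
    rintro υ ⟨h4, h5, h6⟩
    have hz : υ.reg 2 = 0 := by rw [h6 2 (.inl (by omega)), hτ.zero]
    have hk : ∀ r, Kept d k r → υ.reg r = σ.reg r := fun r hr => by
      rw [h6 r (hr.mono le_rfl (by omega)), h3 r hr]
    have ht : υ.reg (tmp k) = if φ.Sat σ.arr ρ then 1 else 0 := by
      rw [h6 _ (.tmp (by omega)), h2]
    rw [h1] at h4 h5
    refine .ifLt (fun h => .copy ?_) (fun h => .const ?_)
    · refine ⟨h4, ?_, fun r hr => by simp [hr.ne_tmp, hk r hr]⟩
      have hφ : φ.Sat σ.arr ρ := by by_contra hn; simp [hz, ht, hn] at h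
      simp [Form.Sat, hφ, h5]
    · refine ⟨h4, ?_, fun r hr => by simp [hr.ne_tmp, hk r hr]⟩
      have hφ : ¬ φ.Sat σ.arr ρ := by intro hn; simp [hz, ht, hn] at h
      simp [Form.Sat, hφ]
  | ex x φ ih =>
    intro d k σ ρ hs hσ hρ
    simp only [Form.closedBelow, Bool.and_eq_true, decide_eq_true_eq] at hs
    obtain ⟨rfl, hs⟩ := hs
    have hne : tmp k ≠ var x := by simp only [tmp, var]; omega
    refine .seq (.const ?_)
    refine (Runs.forN (four_le_var x) (hσ.setReg (four_le_tmp k) _)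
      (fun c υ => υ.arr = σ.arr ∧ (∀ r, Kept x k r → υ.reg r = σ.reg r) ∧
        υ.reg (tmp k) = if ∃ i : Fin N, i < c ∧ φ.Sat σ.arr (Function.update ρ x i) then 1 else 0)
      ⟨rfl, fun r hr => by simp [hr.ne_tmp, hr.ne_var le_rfl], ?_⟩ ?_).mono ?_
    · simp [hne]
    · rintro c hc υ ⟨h1, h2, h3⟩ hR hv
      have hρ' : ∀ y < x + 1, υ.reg (var y) = Function.update ρ x ⟨c, hc⟩ y := by
        intro y hy
        by_cases hxy : y = x
        · subst hxy; simp [hv]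
        · rw [h2 _ (.var (by omega)), hρ y (by omega)]
          simp [hxy]
      refine .seq ((ih (k := k + 1) hs hR hρ').mono ?_)
      rintro τ ⟨h4, h5, h6⟩
      have hR' : Ready N τ := hR.of_eq fun r hr => h6 r (.inl hr)
      have hk : ∀ r, Kept x k r → τ.reg r = σ.reg r := fun r hr => by
        rw [h6 r (hr.mono (by omega) (by omega)), h2 r hr]
      have ht : τ.reg (tmp k) = _ := (h6 _ (.tmp (by omega))).trans h3
      have hx : τ.reg (var x) = c := (h6 _ (.var (by omega))).trans hv
      have hlt : (∃ i : Fin N, i < c + 1 ∧ φ.Sat σ.arr (Function.update ρ x i)) ↔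
          (∃ i : Fin N, i < c ∧ φ.Sat σ.arr (Function.update ρ x i)) ∨
            φ.Sat σ.arr (Function.update ρ x ⟨c, hc⟩) := by
        constructor
        · rintro ⟨i, hi, h⟩
          rcases Nat.lt_succ_iff_lt_or_eq.1 hi with h' | h'
          · exact .inl ⟨i, h', h⟩
          · obtain rfl : i = ⟨c, hc⟩ := Fin.ext h'
            exact .inr h
        · rintro (⟨i, hi, h⟩ | h)
          · exact ⟨i, by omega, h⟩
          · exact ⟨_, Nat.lt_succ_self c, h⟩
      rw [h1] at h4 h5
      refine .ifLt (fun h => .const ?_) (fun h => .copy ?_)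
      · have hφ : φ.Sat σ.arr (Function.update ρ x ⟨c, hc⟩) := by
          by_contra hn; simp [hR'.zero, h5, hn] at h
        refine ⟨hR'.setReg (four_le_tmp k) _, by simp [hne.symm, hx], h4, fun r hr => by
          simp [hr.ne_tmp, hr.ne_var le_rfl, hk r hr], ?_⟩
        rw [if_pos (hlt.2 (.inr hφ))]
        simp [hne]
      · have hφ : ¬ φ.Sat σ.arr (Function.update ρ x ⟨c, hc⟩) := by
          intro hn; simp [hR'.zero, h5, hn] at h
        refine ⟨hR'.setReg (four_le_tmp k) _, by simp [hne.symm, hx], h4, fun r hr => by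
          simp [hr.ne_tmp, hr.ne_var le_rfl, hk r hr], ?_⟩
        simp only [hlt, hφ, or_false]
        simp [hne, ht]
    · rintro τ ⟨⟨h1, h2, h3⟩, -⟩
      refine ⟨h1, ?_, h2⟩
      rw [h3]
      exact if_congr (by simp [Form.Sat]) rfl rfl

/-! ### Filling tables -/

/-- Store the truth value of `φ` in the array `a`, at the index with the digits `args`, for all
values of the variables in the list, the first of which is that of the outermost loop. -/
def fill (a : ℕ) (φ : Form) (args : List ℕ) : List ℕ → Program
  | [] => .seq (φ.code 0) (.seq (index args) (.store a 4 (tmp 0)))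
  | v :: vs => forN (var v) (fill a φ args vs)

/-- Store the relation that `φ` defines in the array `a`. The arguments of the relation are the
variables `2, …, k + 1`; the variables `0` and `1` are parameters. -/
def table (a k : ℕ) (φ : Form) : Program :=
  fill a φ (List.range' 2 k) (List.range' 2 k)

/-- The array entries that are written while the variables below `v` have the values `ρ`. -/
def Block {N : ℕ} (k : ℕ) (a v : ℕ) (ρ : ℕ → Fin N) (b i : ℕ) : Prop :=
  ∃ ρ' : ℕ → Fin N, (∀ x < v, ρ' x = ρ x) ∧ b = a ∧ i = cell ((List.range' 2 k).map ρ')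

/-- The rows of a table are filled in the order of their first argument. Therefore `φ` may refer
to the table itself, as long as its truth depends on earlier rows only: this is what the
hypothesis `H` says. -/
theorem runs_fill {N a k : ℕ} {φ : Form} (hN : 1 < N) (hk : 1 ≤ k) (hφ : φ.closedBelow (k + 2))
    (Q : List (Fin N) → Prop) (j : ℕ) : ∀ (v : ℕ), 2 ≤ v → v + j = k + 2 →
    ∀ (ρ : ℕ → Fin N) (σ : State), Ready N σ → (∀ x < v, σ.reg (var x) = ρ x) →
    (H : ∀ ρ' : ℕ → Fin N, (∀ x < v, ρ' x = ρ x) → ∀ A : ℕ → ℕ → ℕ,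
      (∀ b i, ¬ Block k a v ρ b i → A b i = σ.arr b i) →
      (∀ ρ'' : ℕ → Fin N, (∀ x < v, ρ'' x = ρ x) → ρ'' 2 < ρ' 2 →
        (0 < A a (cell ((List.range' 2 k).map ρ'')) ↔ Q ((List.range' 2 k).map ρ''))) →
      (φ.Sat A ρ' ↔ Q ((List.range' 2 k).map ρ'))) →
    Runs N (fill a φ (List.range' 2 k) (List.range' v j)) σ fun τ =>
      Ready N τ ∧ (∀ x < v, τ.reg (var x) = σ.reg (var x)) ∧
      (∀ b i, ¬ Block k a v ρ b i → τ.arr b i = σ.arr b i) ∧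
      ∀ ρ' : ℕ → Fin N, (∀ x < v, ρ' x = ρ x) →
        (0 < τ.arr a (cell ((List.range' 2 k).map ρ')) ↔ Q ((List.range' 2 k).map ρ')) := by
  induction j with
  | zero =>
    intro v hv hj ρ σ hσ hρ H
    obtain rfl : v = k + 2 := by omega
    have hargs : ∀ ρ' : ℕ → Fin N, (∀ x < k + 2, ρ' x = ρ x) →
        (List.range' 2 k).map ρ' = (List.range' 2 k).map ρ := fun ρ' h =>
      List.map_congr_left fun x hx => h x (by have := List.mem_range'_1.1 hx; omega)
    have hsat : φ.Sat σ.arr ρ ↔ Q ((List.range' 2 k).map ρ) :=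
      H ρ (fun _ _ => rfl) _ (fun _ _ _ => rfl) fun ρ'' h hlt => by
        rw [h 2 (by omega)] at hlt
        exact absurd hlt (lt_irrefl _)
    refine .seq ((runs_code φ hφ hσ hρ).mono ?_)
    rintro τ ⟨h1, h2, h3⟩
    have hτ : Ready N τ := hσ.of_eq fun r hr => h3 r (.inl hr)
    refine .seq ((runs_index hτ _).mono ?_)
    rintro υ ⟨h4, h5, h6⟩
    have hv : ∀ x < k + 2, υ.reg (var x) = σ.reg (var x) := fun x hx => by
      rw [h6 _ (by simp only [var]; omega) (by simp only [var]; omega)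
        (by simp only [var]; omega), h3 _ (.var hx)]
    have hcell : υ.reg 4 = cell ((List.range' 2 k).map ρ) := by
      rw [h5, cell, List.map_map]
      refine congrArg _ (List.map_congr_left fun x hx => ?_)
      have hx' : x < k + 2 := by have := List.mem_range'_1.1 hx; omega
      simp [h3 _ (.var hx'), hρ x hx']
    have ht : υ.reg (tmp 0) = τ.reg (tmp 0) := h6 _ (by simp [tmp]) (by simp [tmp]) (by simp [tmp])
    refine .store ⟨?_, hv, ?_, ?_⟩
    · exact hτ.of_eq fun r hr => h6 r (by omega) (by omega) (by omega)
    · intro b i hb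
      rw [setArr_arr, if_neg, h4, h1]
      rintro ⟨rfl, rfl⟩
      exact hb ⟨ρ, fun _ _ => rfl, rfl, hcell⟩
    · intro ρ' hρ'
      rw [hargs ρ' hρ', setArr_arr, if_pos ⟨rfl, hcell.symm⟩, ht, h2, ← hsat]
      split_ifs with h <;> simp [h]
  | succ j ih =>
    intro v hv hj ρ σ hσ hρ H
    have hsub : ∀ (i : Fin N) (ρ' : ℕ → Fin N), (∀ x < v + 1, ρ' x = Function.update ρ v i x) ↔
        (∀ x < v, ρ' x = ρ x) ∧ ρ' v = i := by
      intro i ρ'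
      constructor
      · intro h
        refine ⟨fun x hx => ?_, by simpa using h v (by omega)⟩
        rw [h x (by omega), Function.update_of_ne (by omega)]
      · rintro ⟨h, rfl⟩ x hx
        rcases Nat.lt_succ_iff_lt_or_eq.1 hx with hx | rfl
        · rw [h x hx, Function.update_of_ne (by omega)]
        · simp
    have hblock : ∀ (i : Fin N) (b c : ℕ), Block k a (v + 1) (Function.update ρ v i) b c →
        Block k a v ρ b c := fun i b c ⟨ρ', h, h'⟩ => ⟨ρ', ((hsub i ρ').1 h).1, h'⟩
    -- Different values of the variable `v` belong to different array entries.
    have hdisj : ∀ (i : Fin N) (ρ' : ℕ → Fin N), ρ' v ≠ i →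
        ¬ Block k a (v + 1) (Function.update ρ v i) a (cell ((List.range' 2 k).map ρ')) := by
      rintro i ρ' hi ⟨ρ'', h, -, hc⟩
      have he := cell_injective hN (by simp) hc
      have hmem : v ∈ List.range' 2 k := List.mem_range'_1.2 (by omega)
      exact hi ((List.map_inj_left.1 he v hmem).trans ((hsub i ρ'').1 h).2)
    have hvar : ∀ x < v, var x ≠ var v := fun x hx => by simp only [var]; omega
    rw [List.range'_succ, fill]
    refine (Runs.forN (four_le_var v) hσ (fun c τ =>
      (∀ x < v, τ.reg (var x) = σ.reg (var x)) ∧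
      (∀ b i, ¬ Block k a v ρ b i → τ.arr b i = σ.arr b i) ∧
      ∀ ρ' : ℕ → Fin N, (∀ x < v, ρ' x = ρ x) → ρ' v < c →
        (0 < τ.arr a (cell ((List.range' 2 k).map ρ')) ↔ Q ((List.range' 2 k).map ρ')))
      ⟨fun x hx => by simp [hvar x hx], fun _ _ _ => rfl, fun ρ' _ h => absurd h (by omega)⟩
      ?_).mono ?_
    · rintro c hc τ ⟨h1, h2, h3⟩ hR hcv
      refine (ih (v + 1) (by omega) (by omega) (Function.update ρ v ⟨c, hc⟩) τ hR ?_ ?_).mono ?_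
      · intro x hx
        rcases Nat.lt_succ_iff_lt_or_eq.1 hx with hx | rfl
        · rw [h1 x hx, hρ x hx, Function.update_of_ne (by omega)]
        · simp [hcv]
      · intro ρ' hρ' A hA hrows
        have hρ1 := (hsub _ ρ').1 hρ'
        refine H ρ' hρ1.1 A (fun b i hb => ?_) fun ρ'' h hlt => ?_
        · rw [hA b i (mt (hblock _ b i) hb), h2 b i hb]
        · rcases hv.lt_or_eq with h2v | rfl
          · rw [h 2 h2v, hρ1.1 2 h2v] at hlt
            exact absurd hlt (lt_irrefl _)
          · rw [hA _ _ (hdisj _ ρ'' (by rw [← hρ1.2]; exact hlt.ne))]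
            refine h3 ρ'' h ?_
            rw [hρ1.2] at hlt
            exact hlt
      · rintro υ ⟨h4, h5, h6, h7⟩
        refine ⟨h4, ?_, fun x hx => ?_, fun b i hb => ?_, fun ρ' hρ' hlt => ?_⟩
        · rw [h5 v (by omega), hcv]
        · rw [setReg_reg, if_neg (hvar x hx), h5 x (by omega), h1 x hx]
        · rw [setReg_arr, h6 b i (mt (hblock _ b i) hb), h2 b i hb]
        · rw [setReg_arr]
          rcases Nat.lt_succ_iff_lt_or_eq.1 hlt with hlt | heq
          · rw [h6 _ _ (hdisj _ ρ' ?_)]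
            · exact h3 ρ' hρ' hlt
            · rintro h
              rw [h] at hlt
              exact lt_irrefl _ hlt
          · exact h7 ρ' ((hsub _ ρ').2 ⟨hρ', Fin.ext heq⟩)
    · rintro τ ⟨⟨h1, h2, h3⟩, hR⟩
      exact ⟨hR, h1, h2, fun ρ' h => h3 ρ' h (ρ' v).2⟩

theorem exists_assignment {N : ℕ} (p q : Fin N) (xs : List (Fin N)) :
    ∃ ρ : ℕ → Fin N, ρ 0 = p ∧ ρ 1 = q ∧ (List.range' 2 xs.length).map ρ = xs := by
  refine ⟨fun x => (p :: q :: xs).getD x p, rfl, rfl, ?_⟩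
  refine List.ext_getElem (by simp) fun i h1 h2 => ?_
  have : 2 + i = i + 1 + 1 := by omega
  simp [this, h2]

/-- The parameters: the variables `0` and `1` have the values `p` and `q`. -/
structure Params {N : ℕ} (p q : Fin N) (σ : State) : Prop where
  ready : Ready N σ
  fst : σ.reg (var 0) = p
  snd : σ.reg (var 1) = q

theorem runs_table {N a k : ℕ} {φ : Form} (hN : 1 < N) (hk : 1 ≤ k) (hφ : φ.closedBelow (k + 2))
    (Q : List (Fin N) → Prop) {p q : Fin N} {σ : State} (hσ : Params p q σ)
    (H : ∀ (ρ : ℕ → Fin N) (A : ℕ → ℕ → ℕ), ρ 0 = p → ρ 1 = q → (∀ b ≠ a, A b = σ.arr b) →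
      (∀ t < ρ 2, ∀ ys : List (Fin N), ys.length + 1 = k →
        (0 < A a (cell (t :: ys)) ↔ Q (t :: ys))) →
      (φ.Sat A ρ ↔ Q ((List.range' 2 k).map ρ))) :
    Runs N (table a k φ) σ fun τ => Params p q τ ∧ (∀ b ≠ a, τ.arr b = σ.arr b) ∧
      ∀ xs : List (Fin N), xs.length = k → (0 < τ.arr a (cell xs) ↔ Q xs) := by
  obtain ⟨ρ, h0, h1, -⟩ := exists_assignment p q []
  have hpar : ∀ {ρ' : ℕ → Fin N}, ρ' 0 = p → ρ' 1 = q → ∀ x < 2, ρ' x = ρ x := by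
    intro ρ' h h' x hx
    interval_cases x <;> simp [*]
  refine (runs_fill hN hk hφ Q k 2 le_rfl (add_comm _ _) ρ σ hσ.ready ?_ ?_).mono ?_
  · intro x hx
    interval_cases x
    · rw [hσ.fst, h0]
    · rw [hσ.snd, h1]
  · intro ρ' hρ' A hA hrows
    refine H ρ' A ?_ ?_ ?_ ?_
    · rw [hρ' 0 (by omega), h0]
    · rw [hρ' 1 (by omega), h1]
    · exact fun b hb => funext fun i => hA b i fun ⟨_, _, h, _⟩ => hb h
    · intro t ht ys hys
      obtain ⟨ρ'', h0', h1', h⟩ := exists_assignment p q (t :: ys)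
      have hlen : (t :: ys).length = k := hys
      rw [hlen] at h
      have := hrows ρ'' (hpar h0' h1') ?_
      · rwa [h] at this
      · obtain ⟨k, rfl⟩ : ∃ k', k = k' + 1 := ⟨k - 1, by omega⟩
        rw [List.range'_succ, List.map_cons, List.cons.injEq] at h
        rw [h.1]
        exact ht
  · rintro τ ⟨hR, hv, h2, h3⟩
    refine ⟨⟨hR, by rw [hv 0 (by omega), hσ.fst], by rw [hv 1 (by omega), hσ.snd]⟩,
      fun b hb => funext fun i => h2 b i fun ⟨_, _, h, _⟩ => hb h, fun xs hxs => ?_⟩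
    obtain ⟨ρ'', h0', h1', h⟩ := exists_assignment p q xs
    rw [hxs] at h
    have := h3 ρ'' (hpar h0' h1')
    rwa [h] at this

/-! ### Reading the input -/

/-- The word `w`, followed by zeros, is in the array `0` from the position in `tmp 0` on. -/
def Pending (w : List ℕ) (σ : State) : Prop :=
  ∀ i, σ.arr 0 (σ.reg (tmp 0) + i) = w.getD i 0

theorem Pending.head {x : ℕ} {w : List ℕ} {σ : State} (h : Pending (x :: w) σ) :
    σ.arr 0 (σ.reg (tmp 0)) = x := by simpa using h 0

theorem Pending.tail {x : ℕ} {w : List ℕ} {σ τ : State} (h : Pending (x :: w) σ)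
    (h0 : τ.arr 0 = σ.arr 0) (hr : τ.reg (tmp 0) = σ.reg (tmp 0) + 1) : Pending w τ := by
  intro i
  rw [h0, hr, add_assoc, add_comm 1 i, h (i + 1), List.getD_cons_succ]

theorem Pending.congr {w : List ℕ} {σ τ : State} (h : Pending w σ)
    (h0 : τ.arr 0 = σ.arr 0) (hr : τ.reg (tmp 0) = σ.reg (tmp 0)) : Pending w τ := by
  intro i
  rw [h0, hr, h i]

/-- Read a list with its length in front, and mark the entries `(k, e)` of the array `a` for all
`e` in the list, where `k` is the value of the variable `2`. -/
def readList (a : ℕ) : Program :=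
  .seq (.load (tmp 1) 0 (tmp 0)) (.seq (.add (tmp 0) (tmp 0) 3)
    (forN (var 4) (.ifLt (var 4) (tmp 1)
      (.seq (.load (var 3) 0 (tmp 0)) (.seq (.add (tmp 0) (tmp 0) 3)
        (.seq (index [2, 3]) (.store a 4 3))))
      (.copy 4 4))))

theorem runs_readList {N a : ℕ} (ha : a ≠ 0) {p q : Fin N} {σ : State} (hσ : Params p q σ)
    {l rest : List ℕ} (hl : l.length ≤ N) (hw : Pending (l.length :: (l ++ rest)) σ) :
    Runs N (readList a) σ fun τ => Params p q τ ∧ τ.reg (var 2) = σ.reg (var 2) ∧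
      Pending rest τ ∧ (∀ b ≠ a, τ.arr b = σ.arr b) ∧
      ∀ i, 0 < τ.arr a i ↔ 0 < σ.arr a i ∨ ∃ e ∈ l, i = Nat.ofDigits N [σ.reg (var 2), e] := by
  obtain ⟨hR, hp, hq⟩ := hσ
  refine .seq (.load (.seq (.add ?_)))
  refine (Runs.forN (four_le_var 4) ((hR.setReg (four_le_tmp 1) _).setReg (four_le_tmp 0) _)
    (fun c τ => τ.reg (var 0) = p ∧ τ.reg (var 1) = q ∧ τ.reg (var 2) = σ.reg (var 2) ∧
      τ.reg (tmp 1) = l.length ∧ Pending (l.drop c ++ rest) τ ∧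
      (∀ b ≠ a, τ.arr b = σ.arr b) ∧ ∀ i, 0 < τ.arr a i ↔
        0 < σ.arr a i ∨ ∃ e ∈ l.take c, i = Nat.ofDigits N [σ.reg (var 2), e]) ?_ ?_).mono ?_
  · refine ⟨by simpa [var, tmp] using hp, by simpa [var, tmp] using hq, by simp [var, tmp],
      by simpa [var, tmp] using hw.head, ?_, fun _ _ => rfl, fun i => by simp⟩
    exact hw.tail rfl (by simp [var, tmp, hR.one])
  · rintro c hc τ ⟨h1, h2, h3, h4, h5, h6, h7⟩ hR' hcv
    refine .ifLt (fun hlt => ?_) (fun hlt => ?_)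
    · rw [hcv, h4] at hlt
      rw [List.drop_eq_getElem_cons hlt, List.cons_append] at h5
      refine .seq (.load (.seq (.add (.seq ?_))))
      refine (runs_index ((hR'.setReg (four_le_var 3) _).setReg (four_le_tmp 0) _) _).mono ?_
      rintro υ ⟨h8, h9, h10⟩
      have hk : ∀ r, r ≠ 4 → r ≠ 5 → r ≠ 6 → r ≠ tmp 0 → r ≠ var 3 → υ.reg r = τ.reg r := by
        intro r r4 r5 r6 r8 r13
        rw [h10 r r4 r5 r6, setReg_reg, if_neg r8, setReg_reg, if_neg r13]
      have h0 : υ.arr = τ.arr := h8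
      have h3' : υ.reg 3 = 1 := by rw [hk 3] <;> simp [var, tmp, hR'.one]
      have h9' : υ.reg 4 = Nat.ofDigits N [σ.reg (var 2), l[c]] := by
        rw [h9]
        have := h5.head
        simp only [var, tmp] at this h3
        simp [var, tmp, this, h3]
      refine .store ⟨?_, ?_, ?_⟩
      · exact hR'.of_eq fun r hr => hk r (by omega) (by omega) (by omega)
          (by simp only [tmp]; omega) (by simp only [var]; omega)
      · rw [setArr_reg, hk, hcv] <;> simp [var, tmp]
      · refine ⟨?_, ?_, ?_, ?_, ?_, ?_, ?_⟩
        · rw [← h1, setReg_reg, if_neg (by simp [var]), setArr_reg, hk] <;> simp [var, tmp]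
        · rw [← h2, setReg_reg, if_neg (by simp [var]), setArr_reg, hk] <;> simp [var, tmp]
        · rw [← h3, setReg_reg, if_neg (by simp [var]), setArr_reg, hk] <;> simp [var, tmp]
        · rw [← h4, setReg_reg, if_neg (by simp [var, tmp]), setArr_reg, hk] <;> simp [var, tmp]
        · refine h5.tail ?_ ?_
          · rw [setReg_arr, ← h0]
            funext i
            rw [setArr_arr, if_neg (fun h => ha h.1.symm)]
          · rw [setReg_reg, if_neg (by simp [var, tmp]), setArr_reg,
              h10 _ (by simp [tmp]) (by simp [tmp]) (by simp [tmp])]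
            simp [var, tmp, hR'.one]
        · intro b hb
          rw [← h6 b hb, ← h0]
          funext i
          rw [setReg_arr, setArr_arr, if_neg (fun h => hb h.1)]
        · intro i
          rw [setReg_arr, setArr_arr, h3', h9', h0, List.take_succ_eq_append_getElem hlt]
          simp only [List.mem_append, List.mem_singleton, true_and]
          split_ifs with h
          · simp only [zero_lt_one, true_iff]
            exact .inr ⟨_, .inr rfl, h⟩
          · rw [h7]
            refine or_congr_right ⟨fun ⟨e, he, h'⟩ => ⟨e, .inl he, h'⟩, ?_⟩
            rintro ⟨e, he | rfl, h'⟩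
            · exact ⟨e, he, h'⟩
            · exact absurd h' h
    · rw [hcv, h4] at hlt
      have hle : l.length ≤ c := by omega
      rw [List.drop_of_length_le hle, List.nil_append] at h5
      rw [List.take_of_length_le hle] at h7
      refine .copy ⟨hR'.setReg le_rfl _, by simp [var] at hcv ⊢; exact hcv, ?_⟩
      rw [List.drop_of_length_le (by omega), List.take_of_length_le (by omega)]
      refine ⟨by simpa [var] using h1, by simpa [var] using h2, by simpa [var] using h3,
        by simpa [var, tmp] using h4, fun i => ?_, h6, h7⟩
      simpa [var, tmp] using h5 i
  · rintro τ ⟨⟨h1, h2, h3, h4, h5, h6, h7⟩, hR'⟩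
    rw [List.drop_of_length_le hl, List.nil_append] at h5
    rw [List.take_of_length_le hl] at h7
    exact ⟨⟨hR', h1, h2⟩, h3, h5, h6, h7⟩

/-- Set up the registers for an input word that begins with `n` and `m`: the variables `0` and `1`
get the values `n` and `m`, and the bound `N` of the loops becomes `n + m + 2`. -/
def setup : Program :=
  .seq (.const 3 1) (.seq (.load (var 0) 0 2) (.seq (.load (var 1) 0 3)
    (.seq (.add 1 (var 0) (var 1)) (.seq (.add 1 1 3) (.seq (.add 1 1 3) (.const (tmp 0) 2))))))

/-- Read the implications: store the membership relations of the premises in the array `1`, and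
those of the conclusions in the array `2`. -/
def readSystem : Program :=
  forN (var 2) (.ifLt (var 2) (var 1) (.seq (readList 1) (readList 2)) (.copy 4 4))

/-- The body of an input word, for implications that are given as lists of numbers. -/
def encodeLists (L : List (List ℕ × List ℕ)) : List ℕ :=
  L.flatMap fun I => (I.1.length :: I.1) ++ (I.2.length :: I.2)

theorem runs_setup {n m N : ℕ} (hN : N = n + m + 2) {p q : Fin N} (hp : (p : ℕ) = n)
    (hq : (q : ℕ) = m) (w : List ℕ) :
    Runs N setup (inputState (n :: m :: w)) fun τ => Params p q τ ∧ Pending w τ ∧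
      ∀ a ≠ 0, ∀ i, τ.arr a i = 0 := by
  refine .seq (.const (.seq (.load (.seq (.load ?_)))))
  refine .seq (.add (.seq (.add (.seq (.add (.const ⟨⟨⟨?_, ?_, ?_⟩, ?_, ?_⟩, ?_, ?_⟩))))))
  · simp [var, tmp, inputState, hN]
  · simp [var, tmp, inputState]
  · simp [var, tmp]
  · simp [var, tmp, inputState, hp]
  · simp [var, tmp, inputState, hq]
  · intro i
    simp [inputState, add_comm 2 i]
  · intro a ha i
    simp [inputState, ha]

theorem runs_readSystem {N : ℕ} (hN : 1 < N) {p q : Fin N} {σ : State} (hσ : Params p q σ)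
    {L : List (List ℕ × List ℕ)} (hq : (q : ℕ) = L.length)
    (hL : ∀ I ∈ L, (I.1.length ≤ N ∧ ∀ e ∈ I.1, e < N) ∧ I.2.length ≤ N ∧ ∀ e ∈ I.2, e < N)
    (hw : Pending (encodeLists L) σ) (h0 : ∀ a ≠ 0, ∀ i, σ.arr a i = 0) :
    Runs N readSystem σ fun τ => Params p q τ ∧ ∀ k e : Fin N,
      (0 < τ.arr 1 (cell [k, e]) ↔ (e : ℕ) ∈ (L.getD k ([], [])).1) ∧
      (0 < τ.arr 2 (cell [k, e]) ↔ (e : ℕ) ∈ (L.getD k ([], [])).2) := by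
  have hcell : ∀ (k e k' : Fin N) (e' : ℕ), e' < N →
      (cell [k, e] = Nat.ofDigits N [(k' : ℕ), e'] ↔ k = k' ∧ (e : ℕ) = e') := by
    intro k e k' e' he'
    constructor
    · intro h
      have := cell_injective hN (xs := [k, e]) (ys := [k', ⟨e', he'⟩]) rfl h
      simp only [List.cons.injEq, and_true] at this
      exact ⟨this.1, by rw [this.2]⟩
    · rintro ⟨rfl, rfl⟩
      rfl
  refine (Runs.forN (four_le_var 2) hσ.ready (fun c τ => Params p q τ ∧
    Pending (encodeLists (L.drop c)) τ ∧ ∀ k e : Fin N,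
      (0 < τ.arr 1 (cell [k, e]) ↔ (k : ℕ) < c ∧ (e : ℕ) ∈ (L.getD k ([], [])).1) ∧
      (0 < τ.arr 2 (cell [k, e]) ↔ (k : ℕ) < c ∧ (e : ℕ) ∈ (L.getD k ([], [])).2))
    ⟨⟨hσ.ready.setReg (four_le_var 2) _, by simpa [var] using hσ.fst,
      by simpa [var] using hσ.snd⟩, hw.congr rfl (by simp [var, tmp]),
      fun k e => by simp [h0]⟩ ?_).mono ?_
  · rintro c hc τ ⟨h1, h2, h3⟩ hR hcv
    refine .ifLt (fun hlt => ?_) (fun hlt => ?_)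
    · rw [hcv, h1.snd, hq] at hlt
      have hI := hL _ (List.getElem_mem hlt)
      have hget : L.getD c ([], []) = L[c] := List.getD_eq_getElem _ _ hlt
      rw [List.drop_eq_getElem_cons hlt, encodeLists, List.flatMap_cons, List.append_assoc,
        List.cons_append] at h2
      refine .seq ((runs_readList one_ne_zero h1 hI.1.1 h2).mono ?_)
      rintro υ ⟨h4, h5, h6, h7, h8⟩
      rw [List.cons_append] at h6
      refine (runs_readList two_ne_zero h4 hI.2.1 h6).mono ?_
      rintro φ ⟨h9, h10, h11, h12, h13⟩
      have hφc : φ.reg (var 2) = c := by rw [h10, h5, hcv]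
      refine ⟨h9.ready, hφc, ⟨h9.ready.setReg (four_le_var 2) _, by simpa [var] using h9.fst,
        by simpa [var] using h9.snd⟩, h11.congr rfl (by simp [var, tmp]), fun k e => ?_⟩
      have hnew : ∀ l : List ℕ, (∀ e ∈ l, e < N) →
          ((∃ e' ∈ l, cell [k, e] = Nat.ofDigits N [c, e']) ↔ (k : ℕ) = c ∧ (e : ℕ) ∈ l) := by
        intro l hl
        constructor
        · rintro ⟨e', he', h⟩
          have := (hcell k e ⟨c, hc⟩ e' (hl e' he')).1 h
          exact ⟨by rw [this.1], by rwa [this.2]⟩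
        · rintro ⟨h, he⟩
          exact ⟨e, he, (hcell k e ⟨c, hc⟩ e e.2).2 ⟨Fin.ext h, rfl⟩⟩
      have hstep : ∀ l l' : List ℕ, (k : ℕ) = c → l = l' →
          ((k : ℕ) < c ∧ (e : ℕ) ∈ l ∨ (k : ℕ) = c ∧ (e : ℕ) ∈ l' ↔
            (k : ℕ) < c + 1 ∧ (e : ℕ) ∈ l) := by
        rintro l l' h rfl
        simp [h]
      constructor
      · rw [setReg_arr, h12 1 (by norm_num), h8, hcv, (h3 k e).1, hnew _ hI.1.2]
        by_cases hkc : (k : ℕ) = c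
        · exact hstep _ _ hkc (by rw [hkc, hget])
        · simp only [hkc, false_and, or_false, Nat.lt_succ_iff_lt_or_eq]
      · rw [setReg_arr, h13, h5, hcv, h7 2 (by norm_num), (h3 k e).2, hnew _ hI.2.2]
        by_cases hkc : (k : ℕ) = c
        · exact hstep _ _ hkc (by rw [hkc, hget])
        · simp only [hkc, false_and, or_false, Nat.lt_succ_iff_lt_or_eq]
    · rw [hcv, h1.snd, hq] at hlt
      refine .copy ⟨h1.ready.setReg le_rfl _, by simp [var] at hcv ⊢; exact hcv,
        ⟨(h1.ready.setReg le_rfl _).setReg (four_le_var 2) _, by simpa [var] using h1.fst,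
        by simpa [var] using h1.snd⟩, fun i => ?_, fun k e => ?_⟩
      · have := h2 i
        rw [List.drop_of_length_le (by omega)] at this ⊢
        simpa [var, tmp] using this
      · have hkc : (k : ℕ) = c → L.getD k ([], []) = ([], []) := fun h =>
          List.getD_eq_default _ _ (by omega)
        rw [setReg_arr, setReg_arr, (h3 k e).1, (h3 k e).2]
        by_cases hkc' : (k : ℕ) = c
        · rw [hkc hkc']
          simp
        · simp only [Nat.lt_succ_iff_lt_or_eq, hkc', or_false, and_self]
  · rintro τ ⟨⟨h1, -, h3⟩, -⟩
    exact ⟨h1, fun k e => by simpa using h3 k e⟩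

end RAM

/-! ### Modularity of a closure system, in local terms -/

section Closure

variable {V : Type*}

/-- The elements `e` whose closure is join irreducible, i.e. those for which the elements of smaller
closure form a closed set. The inconsistent element is included. -/
def joinIrr (cl : ClosureOperator (Set V)) (b : V) : Set V :=
  {e | e = b ∨ cl {f | f ∈ cl {e} ∧ e ∉ cl {f}} ⊆ {f | f ∈ cl {e} ∧ e ∉ cl {f}}}

/-- A set of elements of `joinIrr cl b` that is closed as far as pairs of elements are concerned. -/
def PairClosed (cl : ClosureOperator (Set V)) (b : V) (I : Set V) : Prop :=
  I ⊆ joinIrr cl b ∧ ∀ p ∈ I, ∀ q ∈ I, joinIrr cl b ∩ cl {p, q} ⊆ I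

/-- The modular law for consistent triples of closed sets, and the existence of triple joins. -/
structure ModularClosure (cl : ClosureOperator (Set V)) (b : V) : Prop where
  bot : b ∉ cl ∅
  modular : ∀ x y z u, cl x = x → cl y = y → cl z = z → cl u = u → b ∉ u →
    x ⊆ u → y ⊆ u → z ⊆ u → x ⊆ z → cl (x ∪ y) ∩ z ⊆ cl (x ∪ y ∩ z)
  join : ∀ x y z, cl x = x → cl y = y → cl z = z → b ∉ cl (x ∪ y) → b ∉ cl (y ∪ z) →
    b ∉ cl (z ∪ x) → b ∉ cl (x ∪ y ∪ z)

/-- Local conditions that are equivalent to `ModularClosure`, for a closure operator given by the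
implications `P k → C k`. The condition `pairs` says that `r` is in the smallest pair-closed set
that contains the elements of `joinIrr cl b` below those of `P k`; the other ones are about
boundedly many elements. -/
structure LocallyModular {ι : Type*} (cl : ClosureOperator (Set V)) (b : V) (P C : ι → Set V) :
    Prop where
  bot : ∃ x, b ∉ cl {x}
  pairs : ∀ k, ∀ s ∈ C k, ∀ r ∈ joinIrr cl b, r ∈ cl {s} → ∀ I, PairClosed cl b I →
    (∀ a ∈ P k, joinIrr cl b ∩ cl {a} ⊆ I) → r ∈ I
  join : ∀ p ∈ joinIrr cl b, ∀ p' ∈ joinIrr cl b, ∀ q ∈ joinIrr cl b, ∀ q' ∈ joinIrr cl b,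
    b ∉ cl {p, p'} → b ∉ cl {p, q} → b ∉ cl {p, q'} → b ∉ cl {p', q} → b ∉ cl {p', q'} →
    b ∉ cl {q, q'} → b ∉ cl {p, p', q, q'} ∧
    ∀ s ∈ joinIrr cl b, s ∈ cl {p, p', q, q'} → ∃ x ∈ joinIrr cl b, ∃ y ∈ joinIrr cl b,
      x ∈ cl {p, p'} ∧ y ∈ cl {q, q'} ∧ s ∈ cl {x, y}
  modular : ∀ p ∈ joinIrr cl b, ∀ q ∈ joinIrr cl b, ∀ r ∈ joinIrr cl b, b ∉ cl {p, q} →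
    r ∈ cl {p, q} → r ∈ cl {p} ∨ ∃ x, x ∈ cl {q} ∧ x ∈ cl {p, r} ∧ r ∈ cl {p, x}

variable {cl : ClosureOperator (Set V)} {b : V}

theorem cl_subset_iff {X Y : Set V} : cl X ⊆ cl Y ↔ X ⊆ cl Y := cl.le_closure_iff.symm

theorem cl_subset_of {X Y : Set V} (hY : cl Y = Y) (h : X ⊆ Y) : cl X ⊆ Y := by
  rw [← hY] at h ⊢; exact cl_subset_iff.2 h

theorem subset_cl (X : Set V) : X ⊆ cl X := cl.le_closure X

theorem cl_cl (X : Set V) : cl (cl X) = cl X := cl.idempotent X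

theorem cl_mono {X Y : Set V} (h : X ⊆ Y) : cl X ⊆ cl Y := cl.monotone h

theorem cl_cl_union (X Y : Set V) : cl (cl X ∪ Y) = cl (X ∪ Y) :=
  cl.closure_sup_closure_left X Y

theorem cl_union_cl (X Y : Set V) : cl (X ∪ cl Y) = cl (X ∪ Y) :=
  cl.closure_sup_closure_right X Y

theorem cl_singleton_subset {e : V} {X : Set V} (hX : cl X = X) (h : e ∈ X) : cl {e} ⊆ X :=
  cl_subset_of hX (Set.singleton_subset_iff.2 h)

theorem cl_pair_subset {p q : V} {X : Set V} (hX : cl X = X) (hp : p ∈ X) (hq : q ∈ X) :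
    cl {p, q} ⊆ X :=
  cl_subset_of hX (Set.insert_subset hp (Set.singleton_subset_iff.2 hq))

theorem inter_closed {X Y : Set V} (hX : cl X = X) (hY : cl Y = Y) : cl (X ∩ Y) = X ∩ Y :=
  (Set.subset_inter (cl_subset_of hX Set.inter_subset_left)
    (cl_subset_of hY Set.inter_subset_right)).antisymm (subset_cl _)

theorem mem_cl_singleton (e : V) : e ∈ cl {e} := subset_cl _ rfl

theorem not_mem_of_mem_joinIrr {r : V} (hr : r ∈ joinIrr cl b) (hb : r ≠ b) :
    r ∉ cl {f | f ∈ cl {r} ∧ r ∉ cl {f}} := fun h =>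
  ((hr.resolve_left hb) h).2 (mem_cl_singleton r)

theorem joinIrr_inter_cl_empty (h0 : b ∉ cl ∅) : joinIrr cl b ∩ cl ∅ = ∅ := by
  refine Set.eq_empty_of_forall_notMem fun r hr => ?_
  refine not_mem_of_mem_joinIrr hr.1 ?_ (cl_mono (Set.empty_subset _) hr.2)
  rintro rfl
  exact h0 hr.2

/-- A closed set is spanned by its join irreducible elements. -/
theorem cl_inter_joinIrr [Finite V] {X : Set V} (hX : cl X = X) : cl (X ∩ joinIrr cl b) = X := by
  refine (cl_subset_of hX Set.inter_subset_left).antisymm ?_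
  suffices h : ∀ n : ℕ, ∀ e ∈ X, (cl {e}).ncard = n → e ∈ cl (X ∩ joinIrr cl b) from
    fun e he => h _ e he rfl
  intro n
  induction n using Nat.strong_induction_on with
  | _ n ih =>
    intro e he hn
    by_cases hJ : e ∈ joinIrr cl b
    · exact subset_cl _ ⟨he, hJ⟩
    · have hnot : ¬ cl {f | f ∈ cl {e} ∧ e ∉ cl {f}} ⊆ {f | f ∈ cl {e} ∧ e ∉ cl {f}} :=
        fun h => hJ (.inr h)
      obtain ⟨g, hg, hg'⟩ := Set.not_subset.1 hnot
      have hge : g ∈ cl {e} := cl_subset_of (cl_cl _) (fun f hf => hf.1) hg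
      have heg : e ∈ cl {g} := by
        by_contra h
        exact hg' ⟨hge, h⟩
      have hsub : {f | f ∈ cl {e} ∧ e ∉ cl {f}} ⊆ cl (X ∩ joinIrr cl b) := by
        rintro f ⟨hf, hef⟩
        have hfX : f ∈ X := cl_singleton_subset hX he hf
        refine ih _ ?_ f hfX rfl
        rw [← hn]
        refine Set.ncard_lt_ncard ?_ (Set.toFinite _)
        exact ⟨cl_singleton_subset (cl_cl _) hf, fun h => hef (h (mem_cl_singleton e))⟩
      exact cl_singleton_subset (cl_cl _) (cl_subset_of (cl_cl _) hsub hg) heg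

theorem subset_cl_of_joinIrr_subset [Finite V] {X Y : Set V} (hX : cl X = X)
    (h : X ∩ joinIrr cl b ⊆ cl Y) : X ⊆ cl Y := by
  rw [← cl_inter_joinIrr (b := b) hX]
  exact cl_subset_iff.2 h

/-! ### Necessity of the local conditions -/

/-- In a modular lattice, a join irreducible element `r` of the join of `x` and `y` that is not
below `x` is below the join of `x` and some join irreducible element `f` of `y`. If `y` is minimal,
then `f` generates `y`: otherwise all join irreducible elements of `y` would be in the join of `x`
and the lower cover of `r`, and so would `r`. -/
theorem ModularClosure.exists_joinIrr [Finite V] (hM : ModularClosure cl b) {x y : Set V} {r : V}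
    (hx : cl x = x) (hy : cl y = y) (hb : b ∉ cl (x ∪ y)) (hr : r ∈ joinIrr cl b)
    (hrxy : r ∈ cl (x ∪ y)) (hrx : r ∉ x) : ∃ f ∈ joinIrr cl b, f ∈ y ∧ r ∈ cl (x ∪ {f}) := by
  obtain ⟨z, hzy, hz⟩ := Set.Finite.exists_le_minimal
    (Set.toFinite {z : Set V | cl z = z ∧ z ⊆ y ∧ r ∈ cl (x ∪ z)}) ⟨hy, subset_rfl, hrxy⟩
  obtain ⟨⟨hzc, -, hrz⟩, hmin⟩ := hz
  have hrb : r ≠ b := by rintro rfl; exact hb hrxy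
  have hU : cl (x ∪ z) ⊆ cl (x ∪ y) := cl_mono (Set.union_subset_union_right _ hzy)
  have hbz : b ∉ cl (x ∪ z) := fun h => hb (hU h)
  set R : Set V := {f | f ∈ cl {r} ∧ r ∉ cl {f}} with hR
  have hRc : cl R = R := (hr.resolve_left hrb).antisymm (subset_cl _)
  have hRr : R ⊆ cl {r} := fun f hf => hf.1
  have hrR : r ∉ R := fun h => h.2 (mem_cl_singleton r)
  have hclr : cl {r} ⊆ cl (x ∪ z) := cl_singleton_subset (cl_cl _) hrz
  have hxU : x ⊆ cl (x ∪ z) := Set.subset_union_left.trans (subset_cl _)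
  have hzU : z ⊆ cl (x ∪ z) := Set.subset_union_right.trans (subset_cl _)
  -- elements of `cl {r}` in a closed set without `r`
  have hRmem : ∀ w, cl w = w → r ∉ w → cl {r} ∩ w ⊆ R := fun w hw hrw g hg =>
    ⟨hg.1, fun h => hrw (cl_singleton_subset hw hg.2 h)⟩
  have hrxR : r ∉ cl (x ∪ R) := by
    intro h
    have h1 := hM.modular R x (cl {r}) _ hRc hx (cl_cl _) (cl_cl (x ∪ z)) hbz
      (hRr.trans hclr) hxU hclr hRr
    rw [Set.union_comm] at h
    have h2 : r ∈ cl (R ∪ x ∩ cl {r}) := h1 ⟨h, mem_cl_singleton r⟩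
    refine hrR (cl_subset_of hRc (Set.union_subset subset_rfl ?_) h2)
    rw [Set.inter_comm]
    exact hRmem x hx hrx
  have hzr : z ⊆ cl (x ∪ cl {r}) := by
    have h1 : r ∈ cl (x ∪ z ∩ cl (x ∪ cl {r})) :=
      hM.modular x z (cl (x ∪ cl {r})) _ hx hzc (cl_cl _) (cl_cl (x ∪ z)) hbz hxU hzU
        (cl_subset_iff.2 (Set.union_subset hxU hclr)) (Set.subset_union_left.trans (subset_cl _))
        ⟨hrz, subset_cl _ (.inr (mem_cl_singleton r))⟩
    exact (hmin ⟨inter_closed hzc (cl_cl _), Set.inter_subset_left.trans hzy, h1⟩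
      Set.inter_subset_left).trans Set.inter_subset_right
  by_contra! hno
  refine hrxR ((cl_subset_iff.2 (Set.union_subset (Set.subset_union_left.trans (subset_cl _)) ?_))
    hrz)
  refine subset_cl_of_joinIrr_subset (b := b) hzc fun f hf => ?_
  have hrw : r ∉ cl (x ∪ {f}) := hno f hf.2 (hzy hf.1)
  have h1 := hM.modular x (cl {r}) (cl (x ∪ {f})) _ hx (cl_cl _) (cl_cl _) (cl_cl (x ∪ z)) hbz hxU
    hclr (cl_subset_iff.2 (Set.union_subset hxU (Set.singleton_subset_iff.2 (hzU hf.1))))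
    (Set.subset_union_left.trans (subset_cl _))
  have h2 : f ∈ cl (x ∪ cl {r} ∩ cl (x ∪ {f})) := h1 ⟨hzr hf.1, subset_cl _ (.inr rfl)⟩
  exact cl_mono (Set.union_subset_union_right _ (hRmem _ (cl_cl _) hrw)) h2

theorem ModularClosure.exists_pair [Finite V] (hM : ModularClosure cl b) {x y : Set V} {r : V}
    (hx : cl x = x) (hy : cl y = y) (hb : b ∉ cl (x ∪ y)) (hr : r ∈ joinIrr cl b)
    (hrxy : r ∈ cl (x ∪ y)) : r ∈ x ∨ r ∈ y ∨
      ∃ p ∈ joinIrr cl b, ∃ q ∈ joinIrr cl b, p ∈ x ∧ q ∈ y ∧ r ∈ cl {p, q} := by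
  by_cases hrx : r ∈ x
  · exact .inl hrx
  obtain ⟨q, hq, hqy, hrq⟩ := hM.exists_joinIrr hx hy hb hr hrxy hrx
  have hcq := cl_singleton_subset hy hqy
  by_cases hrq' : r ∈ cl {q}
  · exact .inr (.inl (hcq hrq'))
  obtain ⟨p, hp, hpx, hrp⟩ := hM.exists_joinIrr (x := cl {q}) (y := x) (cl_cl _) hx
    (fun h => hb (by
      rw [Set.union_comm] at h
      exact cl_mono (Set.union_subset_union_right _ hcq) h)) hr
    (by rw [cl_cl_union, Set.union_comm]; exact hrq) hrq'
  refine .inr (.inr ⟨p, hp, q, hq, hpx, hqy, ?_⟩)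
  rwa [cl_cl_union, Set.union_comm, Set.singleton_union] at hrp

/-- Pairwise consistent elements are consistent. -/
theorem ModularClosure.flag [Finite V] (hM : ModularClosure cl b) (T : Set V) :
    ∀ a, (∀ p ∈ insert a T, ∀ q ∈ insert a T, b ∉ cl {p, q}) → b ∉ cl (insert a T) := by
  induction T, T.toFinite using Set.Finite.induction_on with
  | empty =>
    intro a h
    simpa using h a (by simp) a (by simp)
  | @insert c T _ _ ih =>
    intro a h
    have h1 : b ∉ cl (insert c T) := ih c fun p hp q hq => h p (.inr hp) q (.inr hq)
    have h2 : b ∉ cl (insert a T) := ih a fun p hp q hq =>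
      h p (Set.insert_subset_insert (Set.subset_insert _ _) hp) q
        (Set.insert_subset_insert (Set.subset_insert _ _) hq)
    have h3 : b ∉ cl {c, a} := h c (by simp) a (by simp)
    have := hM.join (cl T) (cl {c}) (cl {a}) (cl_cl _) (cl_cl _) (cl_cl _)
      (by rwa [cl_cl_union, cl_union_cl, Set.union_singleton])
      (by rwa [cl_cl_union, cl_union_cl, Set.singleton_union])
      (by rwa [cl_cl_union, cl_union_cl, Set.singleton_union])
    rw [cl_union_cl, Set.union_assoc, cl_cl_union, ← Set.union_assoc, Set.union_right_comm,
      cl_union_cl, Set.union_right_comm, Set.union_singleton, Set.union_singleton] at this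
    exact this

/-- In a modular closure system, sets that are closed under pair closures are closed. -/
theorem ModularClosure.pairClosed [Finite V] (hM : ModularClosure cl b)
    (hbV : ∀ X, cl X = X → b ∈ X → X = Set.univ) {I : Set V} (hI : PairClosed cl b I) :
    joinIrr cl b ∩ cl I ⊆ I := by
  have hbJ : b ∈ joinIrr cl b := .inl rfl
  by_cases hbI : b ∈ I
  · have h := hI.2 b hbI b hbI
    rw [hbV (cl {b, b}) (cl_cl _) (subset_cl _ (by simp)), Set.inter_univ] at h
    exact Set.inter_subset_left.trans h
  have hcons : ∀ p ∈ I, ∀ q ∈ I, b ∉ cl {p, q} := fun p hp q hq h =>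
    hbI (hI.2 p hp q hq ⟨hbJ, h⟩)
  suffices h : ∀ T : Set V, T ⊆ I → joinIrr cl b ∩ cl T ⊆ I from h I subset_rfl
  intro T
  induction T, T.toFinite using Set.Finite.induction_on with
  | empty =>
    intro _
    rw [joinIrr_inter_cl_empty hM.bot]
    exact Set.empty_subset _
  | @insert a T _ _ ih =>
    rintro hT r ⟨hrJ, hr⟩
    have hT' : T ⊆ I := (Set.subset_insert _ _).trans hT
    have ha : a ∈ I := hT (Set.mem_insert _ _)
    have hb : b ∉ cl (insert a T) := hM.flag T a fun p hp q hq => hcons p (hT hp) q (hT hq)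
    have he : cl (cl T ∪ cl {a}) = cl (insert a T) := by
      rw [cl_cl_union, cl_union_cl, Set.union_singleton]
    rw [← he] at hb hr
    rcases hM.exists_pair (cl_cl _) (cl_cl _) hb hrJ hr with h | h | ⟨p, hp, q, hq, hpT, hqa, h⟩
    · exact ih hT' ⟨hrJ, h⟩
    · exact hI.2 a ha a ha ⟨hrJ, by simpa using h⟩
    · exact hI.2 p (ih hT' ⟨hp, hpT⟩) q (hI.2 a ha a ha ⟨hq, by simpa using hqa⟩) ⟨hrJ, h⟩

theorem ModularClosure.locallyModular [Finite V] {ι : Type*} {P C : ι → Set V}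
    (hM : ModularClosure cl b) (hbV : ∀ X, cl X = X → b ∈ X → X = Set.univ)
    (hC : ∀ k, C k ⊆ cl (P k)) (hne : ∃ e, e ∈ cl ∅) : LocallyModular cl b P C where
  bot := by
    obtain ⟨e, he⟩ := hne
    exact ⟨e, fun h => hM.bot (cl_singleton_subset (cl_cl _) he h)⟩
  pairs := by
    intro k s hs r hrJ hrs I hI hPI
    refine hM.pairClosed hbV hI ⟨hrJ, ?_⟩
    have hP : P k ⊆ cl I := by
      intro a ha
      refine subset_cl_of_joinIrr_subset (b := b) (cl_cl {a}) ?_ (mem_cl_singleton a)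
      rw [Set.inter_comm]
      exact (hPI a ha).trans (subset_cl _)
    exact cl_singleton_subset (cl_cl _) (cl_subset_iff.2 hP (hC k hs)) hrs
  join := by
    intro p hp p' hp' q hq q' hq' h1 h2 h3 h4 h5 h6
    have hb : b ∉ cl {p, p', q, q'} := by
      refine hM.flag {p', q, q'} p fun x hx y hy => ?_
      have key : ∀ {u v}, b ∉ cl {u, v} → b ∉ cl {v, u} ∧ b ∉ cl {u, u} ∧ b ∉ cl {v, v} := by
        intro u v h
        refine ⟨by rwa [Set.pair_comm], fun h' => h (cl_mono (by simp) h'),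
          fun h' => h (cl_mono (by simp) h')⟩
      simp only [Set.mem_insert_iff, Set.mem_singleton_iff] at hx hy
      rcases hx with rfl | rfl | rfl | rfl <;> rcases hy with rfl | rfl | rfl | rfl <;>
        first
        | assumption
        | exact (key (by assumption)).1
        | exact (key h1).2.1
        | exact (key h1).2.2
        | exact (key h6).2.1
        | exact (key h6).2.2
    have he : cl (cl {p, p'} ∪ cl {q, q'}) = cl {p, p', q, q'} := by
      rw [cl_cl_union, cl_union_cl, Set.insert_union, Set.singleton_union]
    refine ⟨hb, fun s hs hs' => ?_⟩
    rw [← he] at hb hs'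
    rcases hM.exists_pair (cl_cl _) (cl_cl _) hb hs hs' with h | h | ⟨x, hx, y, hy, h7, h8, h9⟩
    · exact ⟨s, hs, q, hq, h, subset_cl _ (by simp), subset_cl _ (by simp)⟩
    · exact ⟨p, hp, s, hs, subset_cl _ (by simp), h, subset_cl _ (by simp)⟩
    · exact ⟨x, hx, y, hy, h7, h8, h9⟩
  modular := by
    intro p hp q hq r hr hb hrpq
    have hpU : cl {p} ⊆ cl {p, q} := cl_mono (by simp)
    have hqU : cl {q} ⊆ cl {p, q} := cl_mono (by simp)
    have hprU : cl {p, r} ⊆ cl {p, q} := cl_pair_subset (cl_cl _) (subset_cl _ (by simp)) hrpq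
    have h1 : r ∈ cl (cl {p} ∪ cl {q} ∩ cl {p, r}) :=
      hM.modular (cl {p}) (cl {q}) (cl {p, r}) _ (cl_cl _) (cl_cl _) (cl_cl _) (cl_cl {p, q}) hb
        hpU hqU hprU (cl_mono (by simp))
        ⟨by rwa [cl_cl_union, cl_union_cl, Set.singleton_union], subset_cl _ (by simp)⟩
    have hb' : b ∉ cl (cl {p} ∪ cl {q} ∩ cl {p, r}) := fun h =>
      hb (cl_subset_of (cl_cl _) (Set.union_subset hpU (Set.inter_subset_left.trans hqU)) h)
    rcases hM.exists_pair (cl_cl _) (inter_closed (cl_cl _) (cl_cl _)) hb' hr h1 with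
      h | h | ⟨x, hx, y, hy, h7, h8, h9⟩
    · exact .inl h
    · exact .inr ⟨r, h.1, h.2, subset_cl _ (by simp)⟩
    · refine .inr ⟨y, h8.1, h8.2, ?_⟩
      refine cl_pair_subset (cl_cl _) ?_ (subset_cl _ (by simp)) h9
      exact cl_mono (by simp) h7

/-! ### Sufficiency of the local conditions -/

variable {ι : Type*} {P C : ι → Set V}

theorem LocallyModular.not_mem_cl_empty (h : LocallyModular cl b P C) : b ∉ cl ∅ := by
  obtain ⟨x, hx⟩ := h.bot
  exact fun h => hx (cl_mono (Set.empty_subset _) h)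

/-- By the condition on pairs, the elements `e` such that `I` contains all join irreducible elements
of `cl {e}` form a closed set. -/
theorem LocallyModular.pairClosed (h : LocallyModular cl b P C)
    (hbV : ∀ X, cl X = X → b ∈ X → X = Set.univ)
    (hcl : ∀ X, cl ∅ ⊆ X → (b ∈ X → X = Set.univ) → (∀ k, P k ⊆ X → C k ⊆ X) → cl X = X)
    {I : Set V} (hI : PairClosed cl b I) : joinIrr cl b ∩ cl I ⊆ I := by
  have hself : ∀ a ∈ I, joinIrr cl b ∩ cl {a} ⊆ I := fun a ha => by
    simpa using hI.2 a ha a ha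
  have hX : cl {e | joinIrr cl b ∩ cl {e} ⊆ I} = {e | joinIrr cl b ∩ cl {e} ⊆ I} := by
    refine hcl _ (fun e he => ?_) (fun hb => ?_) fun k hk s hs r hr => ?_
    · refine (Set.inter_subset_inter_right _ (cl_singleton_subset (cl_cl _) he)).trans ?_
      rw [joinIrr_inter_cl_empty h.not_mem_cl_empty]
      exact Set.empty_subset _
    · have hbI : b ∈ I := hb ⟨.inl rfl, mem_cl_singleton b⟩
      have hJ := hself b hbI
      rw [hbV (cl {b}) (cl_cl _) (mem_cl_singleton b), Set.inter_univ] at hJ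
      exact Set.eq_univ_of_forall fun e => Set.inter_subset_left.trans hJ
    · exact h.pairs k s hs r hr.1 hr.2 I hI fun a ha => hk ha
  exact fun r hr => cl_subset_of hX hself hr.2 ⟨hr.1, mem_cl_singleton r⟩

/-- If the join irreducible elements of `x` and of `y` are consistent, then `x` and `y` are, and
their join is the union of the closures of pairs. -/
theorem LocallyModular.exists_pair [Finite V] (h : LocallyModular cl b P C)
    (hbV : ∀ X, cl X = X → b ∈ X → X = Set.univ)
    (hcl : ∀ X, cl ∅ ⊆ X → (b ∈ X → X = Set.univ) → (∀ k, P k ⊆ X → C k ⊆ X) → cl X = X)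
    {x y : Set V} (hx : cl x = x) (hy : cl y = y) (hbx : b ∉ x) (hby : b ∉ y)
    (hc : ∀ p ∈ joinIrr cl b, ∀ q ∈ joinIrr cl b, p ∈ x → q ∈ y → b ∉ cl {p, q}) :
    b ∉ cl (x ∪ y) ∧ ∀ s ∈ joinIrr cl b, s ∈ cl (x ∪ y) → s ∈ x ∨ s ∈ y ∨
      ∃ p ∈ joinIrr cl b, ∃ q ∈ joinIrr cl b, p ∈ x ∧ q ∈ y ∧ s ∈ cl {p, q} := by
  set I : Set V := {s | s ∈ joinIrr cl b ∧ (s ∈ x ∨ s ∈ y ∨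
      ∃ p ∈ joinIrr cl b, ∃ q ∈ joinIrr cl b, p ∈ x ∧ q ∈ y ∧ s ∈ cl {p, q})} with hI
  have hpc : PairClosed cl b I := by
    refine ⟨fun s hs => hs.1, fun s hs s' hs' r hr => ⟨hr.1, ?_⟩⟩
    by_cases hx0 : ∃ p ∈ joinIrr cl b, p ∈ x
    swap
    · have hmem : ∀ t ∈ I, t ∈ y := by
        rintro t ⟨ht, h1 | h1 | ⟨p, hp, -, -, hpx, -⟩⟩
        · exact absurd ⟨t, ht, h1⟩ hx0
        · exact h1
        · exact absurd ⟨p, hp, hpx⟩ hx0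
      exact .inr (.inl (cl_pair_subset hy (hmem s hs) (hmem s' hs') hr.2))
    by_cases hy0 : ∃ q ∈ joinIrr cl b, q ∈ y
    swap
    · have hmem : ∀ t ∈ I, t ∈ x := by
        rintro t ⟨ht, h1 | h1 | ⟨-, -, q, hq, -, hqy, -⟩⟩
        · exact h1
        · exact absurd ⟨t, ht, h1⟩ hy0
        · exact absurd ⟨q, hq, hqy⟩ hy0
      exact .inl (cl_pair_subset hx (hmem s hs) (hmem s' hs') hr.2)
    obtain ⟨p₀, hp₀, hpx₀⟩ := hx0
    obtain ⟨q₀, hq₀, hqy₀⟩ := hy0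
    have hmem : ∀ t ∈ I, ∃ p ∈ joinIrr cl b, ∃ q ∈ joinIrr cl b, p ∈ x ∧ q ∈ y ∧
        t ∈ cl {p, q} := by
      rintro t ⟨ht, h1 | h1 | h1⟩
      · exact ⟨t, ht, q₀, hq₀, h1, hqy₀, subset_cl _ (by simp)⟩
      · exact ⟨p₀, hp₀, t, ht, hpx₀, h1, subset_cl _ (by simp)⟩
      · exact h1
    obtain ⟨p, hp, q, hq, hpx, hqy, hs1⟩ := hmem s hs
    obtain ⟨p', hp', q', hq', hpx', hqy', hs2⟩ := hmem s' hs'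
    have hr4 : r ∈ cl {p, p', q, q'} := by
      refine cl_pair_subset (cl_cl _) ?_ ?_ hr.2
      · refine cl_mono ?_ hs1
        rintro z (rfl | rfl) <;> simp
      · refine cl_mono ?_ hs2
        rintro z (rfl | rfl) <;> simp
    obtain ⟨u, hu, v, hv, hup, hvq, hruv⟩ := (h.join p hp p' hp' q hq q' hq'
      (fun hb => hbx (cl_pair_subset hx hpx hpx' hb)) (hc p hp q hq hpx hqy)
      (hc p hp q' hq' hpx hqy') (hc p' hp' q hq hpx' hqy) (hc p' hp' q' hq' hpx' hqy')
      (fun hb => hby (cl_pair_subset hy hqy hqy' hb))).2 r hr.1 hr4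
    exact .inr (.inr ⟨u, hu, v, hv, cl_pair_subset hx hpx hpx' hup,
      cl_pair_subset hy hqy hqy' hvq, hruv⟩)
  have hJI := h.pairClosed hbV hcl hpc
  have hxy : cl (x ∪ y) ⊆ cl I := by
    refine cl_subset_iff.2 (Set.union_subset ?_ ?_)
    · exact subset_cl_of_joinIrr_subset (b := b) hx fun s hs => subset_cl _ ⟨hs.2, .inl hs.1⟩
    · exact subset_cl_of_joinIrr_subset (b := b) hy fun s hs =>
        subset_cl _ ⟨hs.2, .inr (.inl hs.1)⟩
  refine ⟨fun hb => ?_, fun s hs hsxy => (hJI ⟨hs, hxy hsxy⟩).2⟩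
  rcases (hJI ⟨.inl rfl, hxy hb⟩).2 with h1 | h1 | ⟨p, hp, q, hq, hpx, hqy, h1⟩
  · exact hbx h1
  · exact hby h1
  · exact hc p hp q hq hpx hqy h1

theorem LocallyModular.modularClosure [Finite V] (h : LocallyModular cl b P C)
    (hbV : ∀ X, cl X = X → b ∈ X → X = Set.univ)
    (hcl : ∀ X, cl ∅ ⊆ X → (b ∈ X → X = Set.univ) → (∀ k, P k ⊆ X → C k ⊆ X) → cl X = X) :
    ModularClosure cl b where
  bot := h.not_mem_cl_empty
  modular := by
    intro x y z u hx hy hz hu hbu hxu hyu hzu hxz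
    have hxyu : cl (x ∪ y) ⊆ u := cl_subset_of hu (Set.union_subset hxu hyu)
    refine subset_cl_of_joinIrr_subset (b := b) (inter_closed (cl_cl _) hz) ?_
    rintro r ⟨⟨hr, hrz⟩, hrJ⟩
    rcases (h.exists_pair hbV hcl hx hy (fun hb => hbu (hxu hb)) (fun hb => hbu (hyu hb))
      fun p hp q hq hpx hqy hb => hbu (cl_pair_subset hu (hxu hpx) (hyu hqy) hb)).2 r hrJ hr with
      h1 | h1 | ⟨p, hp, q, hq, hpx, hqy, h1⟩
    · exact subset_cl _ (.inl h1)
    · exact subset_cl _ (.inr ⟨h1, hrz⟩)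
    · rcases h.modular p hp q hq r hrJ
        (fun hb => hbu (cl_pair_subset hu (hxu hpx) (hyu hqy) hb)) h1 with h2 | ⟨t, h2, h3, h4⟩
      · exact subset_cl _ (.inl (cl_singleton_subset hx hpx h2))
      · refine cl_mono ?_ h4
        rintro _ (rfl | rfl)
        · exact .inl hpx
        · exact .inr ⟨cl_singleton_subset hy hqy h2, cl_pair_subset hz (hxz hpx) hrz h3⟩
  join := by
    intro x y z hx hy hz hxy hyz hzx
    have hpair : ∀ {X : Set V} {p q : V}, p ∈ X → q ∈ X → b ∉ cl X → b ∉ cl {p, q} :=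
      fun hp hq hb hb' => hb (cl_pair_subset (cl_cl _) (subset_cl _ hp) (subset_cl _ hq) hb')
    have hbx : b ∉ x := fun hb => hxy (subset_cl _ (.inl hb))
    have hby : b ∉ y := fun hb => hxy (subset_cl _ (.inr hb))
    have hbz : b ∉ z := fun hb => hyz (subset_cl _ (.inr hb))
    have hj := (h.exists_pair hbV hcl hx hy hbx hby fun p hp q hq hpx hqy =>
      hpair (.inl hpx) (.inr hqy) hxy).2
    have hk := (h.exists_pair hbV hcl (cl_cl (x ∪ y)) hz hxy hbz fun s hs r hr hsxy hrz => ?_).1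
    · rwa [cl_cl_union] at hk
    rcases hj s hs hsxy with h1 | h1 | ⟨p, hp, q, hq, hpx, hqy, h1⟩
    · exact hpair (.inr h1) (.inl hrz) hzx
    · exact hpair (.inl h1) (.inr hrz) hyz
    · have h2 := (h.join p hp q hq r hr r hr (hpair (.inl hpx) (.inr hqy) hxy)
        (hpair (.inr hpx) (.inl hrz) hzx) (hpair (.inr hpx) (.inl hrz) hzx)
        (hpair (.inl hqy) (.inr hrz) hyz) (hpair (.inl hqy) (.inr hrz) hyz)
        (hpair (.inr hrz) (.inr hrz) hyz)).1
      refine fun hb => h2 (cl_pair_subset (cl_cl _) ?_ (subset_cl _ (by simp)) hb)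
      refine cl_mono ?_ h1
      rintro t (rfl | rfl) <;> simp

/-! ### Modular semilattices of closed sets -/

theorem isModularLatticeOrder_iff {Q : Type*} [inst : PartialOrder Q] :
    IsModularLatticeOrder Q ↔ ∃ sup inf : Q → Q → Q, (∀ x y, IsLUB {x, y} (sup x y)) ∧
      (∀ x y, IsGLB {x, y} (inf x y)) ∧
      ∀ x y z, x ≤ z → inf (sup x y) z ≤ sup x (inf y z) := by
  constructor
  · rintro ⟨L, rfl, hL⟩
    exact ⟨fun x y => x ⊔ y, fun x y => x ⊓ y, fun x y => isLUB_pair, fun x y => isGLB_pair,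
      fun x y z h => hL.sup_inf_le_assoc_of_le y h⟩
  · rintro ⟨sup, inf, h1, h2, h3⟩
    refine ⟨{ inst with
      sup := sup
      inf := inf
      le_sup_left := fun x y => (h1 x y).1 (by simp)
      le_sup_right := fun x y => (h1 x y).1 (by simp)
      sup_le := fun x y z hx hy => (h1 x y).2 (by simp [hx, hy])
      inf_le_left := fun x y => (h2 x y).1 (by simp)
      inf_le_right := fun x y => (h2 x y).1 (by simp)
      le_inf := fun x y z hx hy => (h2 y z).2 (by simp [hx, hy]) }, rfl, ?_⟩
    exact @IsModularLattice.mk _ (_) fun {x} y {z} hxz => h3 x y z hxz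

/-- A partial order that is represented by the closed sets without `b` is a modular semilattice if
and only if the closure system is modular in the sense of `ModularClosure`. -/
theorem isModularSemilattice_iff {Q : Type*} [PartialOrder Q] (f : Q → Set V)
    (hle : ∀ x y, x ≤ y ↔ f x ⊆ f y) (hf : ∀ x, cl (f x) = f x) (hfb : ∀ x, b ∉ f x)
    (hsurj : ∀ X, cl X = X → b ∉ X → ∃ x, f x = X) :
    IsModularSemilattice Q ↔ ModularClosure cl b := by
  have hlub : ∀ T : Set Q, (∃ j, IsLUB T j) ↔ b ∉ cl (⋃ t ∈ T, f t) := by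
    intro T
    constructor
    · rintro ⟨j, hj⟩ hb
      refine hfb j (cl_subset_of (hf j) (Set.iUnion₂_subset fun t ht => ?_) hb)
      exact (hle t j).1 (hj.1 ht)
    · intro hb
      obtain ⟨j, hj⟩ := hsurj _ (cl_cl _) hb
      refine ⟨j, fun t ht => ?_, fun u hu => ?_⟩
      · rw [hle, hj]
        exact (Set.subset_biUnion_of_mem (u := f) ht).trans (subset_cl _)
      · rw [hle, hj]
        exact cl_subset_of (hf u) (Set.iUnion₂_subset fun t ht => (hle t u).1 (hu ht))
  have hlub2 : ∀ x y, (∃ j, IsLUB {x, y} j) ↔ b ∉ cl (f x ∪ f y) := fun x y => by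
    rw [hlub, Set.biUnion_pair]
  have hlub3 : ∀ x y z, (∃ j, IsLUB {x, y, z} j) ↔ b ∉ cl (f x ∪ f y ∪ f z) := fun x y z => by
    rw [hlub, Set.biUnion_insert, Set.biUnion_pair, Set.union_assoc]
  constructor
  · intro h
    refine ⟨?_, ?_, ?_⟩
    · obtain ⟨x⟩ := h.nonempty
      exact fun hb => hfb x (cl_subset_of (hf x) (Set.empty_subset _) hb)
    · intro X Y Z U hX hY hZ hU hb hXU hYU hZU hXZ
      obtain ⟨u, rfl⟩ := hsurj U hU hb
      obtain ⟨x, rfl⟩ := hsurj X hX fun h => hb (hXU h)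
      obtain ⟨y, rfl⟩ := hsurj Y hY fun h => hb (hYU h)
      obtain ⟨z, rfl⟩ := hsurj Z hZ fun h => hb (hZU h)
      obtain ⟨sup, inf, h1, h2, h3⟩ := isModularLatticeOrder_iff.1 (h.principalIdeal_modular u)
      have hsup : ∀ v w : Set.Iic u, f (sup v w).1 ⊆ cl (f v.1 ∪ f w.1) := by
        intro v w
        have hu : cl (f v.1 ∪ f w.1) ⊆ f u := cl_subset_of (hf u)
          (Set.union_subset ((hle _ _).1 v.2) ((hle _ _).1 w.2))
        obtain ⟨j, hj⟩ := hsurj _ (cl_cl _) fun h => hb (hu h)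
        have hju : j ≤ u := by rw [hle, hj]; exact hu
        rw [← hj]
        suffices h : sup v w ≤ (⟨j, hju⟩ : Set.Iic u) from (hle _ _).1 h
        refine (h1 v w).2 ?_
        rintro t (rfl | rfl)
        · refine (hle _ _).2 ?_
          rw [hj]
          exact Set.subset_union_left.trans (subset_cl _)
        · refine (hle _ _).2 ?_
          rw [hj]
          exact Set.subset_union_right.trans (subset_cl _)
      have hinf : ∀ v w : Set.Iic u, f (inf v w).1 = f v.1 ∩ f w.1 := by
        intro v w
        refine (Set.subset_inter ?_ ?_).antisymm ?_
        · exact (hle _ _).1 ((h2 v w).1 (by simp))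
        · exact (hle _ _).1 ((h2 v w).1 (by simp))
        · obtain ⟨j, hj⟩ := hsurj _ (inter_closed (hf v.1) (hf w.1)) fun h => hfb _ h.1
          have hju : j ≤ u := by
            rw [hle, hj]
            exact Set.inter_subset_left.trans ((hle _ _).1 v.2)
          rw [← hj]
          suffices h : (⟨j, hju⟩ : Set.Iic u) ≤ inf v w from (hle _ _).1 h
          refine (h2 v w).2 ?_
          rintro t (rfl | rfl)
          · refine (hle _ _).2 ?_
            rw [hj]
            exact Set.inter_subset_left
          · refine (hle _ _).2 ?_
            rw [hj]
            exact Set.inter_subset_right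
      have h4 := (hle _ _).1 (h3 ⟨x, (hle _ _).2 hXU⟩ ⟨y, (hle _ _).2 hYU⟩ ⟨z, (hle _ _).2 hZU⟩
        ((hle _ _).2 hXZ))
      have h5 := hsup ⟨x, (hle _ _).2 hXU⟩ (inf ⟨y, (hle _ _).2 hYU⟩ ⟨z, (hle _ _).2 hZU⟩)
      rw [hinf] at h4 h5
      refine Set.Subset.trans (Set.inter_subset_inter_left _ ?_) (h4.trans h5)
      refine cl_subset_of (hf _) (Set.union_subset ?_ ?_)
      · exact (hle _ _).1 ((h1 ⟨x, (hle _ _).2 hXU⟩ ⟨y, (hle _ _).2 hYU⟩).1 (Set.mem_insert _ _))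
      · exact (hle _ _).1
          ((h1 ⟨x, (hle _ _).2 hXU⟩ ⟨y, (hle _ _).2 hYU⟩).1 (Set.mem_insert_of_mem _ rfl))
    · intro X Y Z hX hY hZ hXY hYZ hZX
      obtain ⟨x, rfl⟩ := hsurj X hX fun h => hXY (subset_cl _ (.inl h))
      obtain ⟨y, rfl⟩ := hsurj Y hY fun h => hXY (subset_cl _ (.inr h))
      obtain ⟨z, rfl⟩ := hsurj Z hZ fun h => hYZ (subset_cl _ (.inr h))
      rw [← hlub2] at hXY hYZ hZX
      rw [← hlub3]
      exact h.exists_join x y z hXY hYZ hZX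
  · intro h
    refine ⟨?_, ?_, ?_, ?_⟩
    · obtain ⟨x, -⟩ := hsurj _ (cl_cl _) h.bot
      exact ⟨x⟩
    · intro x y
      obtain ⟨m, hm⟩ := hsurj _ (inter_closed (hf x) (hf y)) fun h => hfb _ h.1
      refine ⟨m, ?_, fun t ht => ?_⟩
      · rintro t (rfl | rfl)
        · rw [hle, hm]
          exact Set.inter_subset_left
        · rw [hle, hm]
          exact Set.inter_subset_right
      · rw [hle, hm]
        exact Set.subset_inter ((hle _ _).1 (ht (by simp))) ((hle _ _).1 (ht (by simp)))
    · intro u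
      have hjoin : ∀ x y : Set.Iic u, ∃ j : Set.Iic u, f j.1 = cl (f x.1 ∪ f y.1) := by
        intro x y
        have hu : cl (f x.1 ∪ f y.1) ⊆ f u := cl_subset_of (hf u)
          (Set.union_subset ((hle _ _).1 x.2) ((hle _ _).1 y.2))
        obtain ⟨j, hj⟩ := hsurj _ (cl_cl _) fun h => hfb u (hu h)
        exact ⟨⟨j, by rw [Set.mem_Iic, hle, hj]; exact hu⟩, hj⟩
      have hmeet : ∀ x y : Set.Iic u, ∃ j : Set.Iic u, f j.1 = f x.1 ∩ f y.1 := by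
        intro x y
        obtain ⟨j, hj⟩ := hsurj _ (inter_closed (hf x.1) (hf y.1)) fun h => hfb _ h.1
        refine ⟨⟨j, ?_⟩, hj⟩
        rw [Set.mem_Iic, hle, hj]
        exact Set.inter_subset_left.trans ((hle _ _).1 x.2)
      choose sup hsup using hjoin
      choose inf hinf using hmeet
      have hle' : ∀ x y : Set.Iic u, x ≤ y ↔ f x.1 ⊆ f y.1 := fun x y => hle x.1 y.1
      refine isModularLatticeOrder_iff.2 ⟨sup, inf, fun x y => ⟨?_, fun t ht => ?_⟩,
        fun x y => ⟨?_, fun t ht => ?_⟩, fun x y z hxz => ?_⟩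
      · rintro t (rfl | rfl)
        · rw [hle', hsup]
          exact Set.subset_union_left.trans (subset_cl _)
        · rw [hle', hsup]
          exact Set.subset_union_right.trans (subset_cl _)
      · rw [hle', hsup]
        exact cl_subset_of (hf _) (Set.union_subset ((hle' _ _).1 (ht (by simp)))
          ((hle' _ _).1 (ht (by simp))))
      · rintro t (rfl | rfl)
        · rw [hle', hinf]
          exact Set.inter_subset_left
        · rw [hle', hinf]
          exact Set.inter_subset_right
      · rw [hle', hinf]
        exact Set.subset_inter ((hle' _ _).1 (ht (by simp))) ((hle' _ _).1 (ht (by simp)))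
      · rw [hle', hinf, hsup, hsup, hinf]
        exact h.modular _ _ _ (f u) (hf _) (hf _) (hf _) (hf u) (hfb u) ((hle _ _).1 x.2)
          ((hle _ _).1 y.2) ((hle _ _).1 z.2) ((hle' _ _).1 hxz)
    · intro x y z hxy hyz hzx
      rw [hlub2] at hxy hyz hzx
      rw [hlub3]
      exact h.join _ _ _ (hf x) (hf y) (hf z) hxy hyz hzx

end Closure

/-! ### Least fixed points on a finite set -/

theorem mem_iterate_empty_iff {V : Type*} {Φ : Set V → Set V} (hΦ : Monotone Φ) (t : ℕ) (s : V) :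
    s ∈ Φ^[t] ∅ ↔ ∃ t' < t, s ∈ Φ^[t' + 1] ∅ := by
  have hmono := hΦ.monotone_iterate_of_le_map (Set.empty_subset (Φ ∅))
  constructor
  · intro h
    cases t with
    | zero => exact absurd h (Set.notMem_empty s)
    | succ t => exact ⟨t, t.lt_succ_self, h⟩
  · rintro ⟨t', ht', h⟩
    exact hmono (Nat.succ_le_of_lt ht') h

/-- On a set with `N` elements, the iteration of a monotone operator from the empty set is at the
least fixed point after `N` stages. -/
theorem exists_mem_iterate_iff {N : ℕ} {Φ : Set (Fin N) → Set (Fin N)} (hΦ : Monotone Φ)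
    (s : Fin N) : (∃ t : Fin N, s ∈ Φ^[(t : ℕ) + 1] ∅) ↔ ∀ X, Φ X ⊆ X → s ∈ X := by
  have hmono := hΦ.monotone_iterate_of_le_map (Set.empty_subset (Φ ∅))
  constructor
  · rintro ⟨t, ht⟩ X hX
    have : ∀ t : ℕ, Φ^[t] ∅ ⊆ X := by
      intro t
      induction t with
      | zero => exact Set.empty_subset X
      | succ t ih =>
        rw [Function.iterate_succ_apply']
        exact (hΦ ih).trans hX
    exact this _ ht
  · intro h
    have hfix : ∃ t ≤ N, Φ^[t + 1] ∅ ⊆ Φ^[t] ∅ := by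
      by_contra! hno
      have hcard : ∀ t ≤ N + 1, t ≤ (Φ^[t] ∅).ncard := by
        intro t
        induction t with
        | zero => simp
        | succ t ih =>
          intro ht
          have hlt : Φ^[t] ∅ ⊂ Φ^[t + 1] ∅ := ⟨hmono (Nat.le_succ t), hno t (by omega)⟩
          have := Set.ncard_lt_ncard hlt (Set.toFinite _)
          have := ih (by omega)
          omega
      have h1 := hcard (N + 1) le_rfl
      have h2 := Set.ncard_le_ncard (Set.subset_univ (Φ^[N + 1] ∅)) (Set.toFinite _)
      rw [Set.ncard_univ, Nat.card_fin] at h2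
      omega
    obtain ⟨t, ht, hle⟩ := hfix
    rw [Function.iterate_succ_apply'] at hle
    have hs := h _ hle
    obtain ⟨t', ht', hs'⟩ := (mem_iterate_empty_iff hΦ t s).1 hs
    exact ⟨⟨t', by omega⟩, hs'⟩

namespace RAM

/-! ### The closure operator of an input -/

section
variable {N : ℕ} (p q : Fin N) (Pr Co : Fin N → Set (Fin N))

/-- The conclusion of the implication `k`, if there is one, i.e. for `k < q`. The conclusion of an
improper implication is the inconsistent element `p`. -/
def conclusion (k : Fin N) : Set (Fin N) :=
  {s | k < q ∧ (s ∈ Co k ∨ s = p ∧ ∀ e, e ∉ Co k)}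

/-- The elements that are derived from `X` in one step. The elements above `p`, which only
pad the ground set to `N` elements, are derived from nothing, and everything is derived from `p`. -/
def derived (X : Set (Fin N)) : Set (Fin N) :=
  {s | p < s ∨ p ∈ X ∨ ∃ k, s ∈ conclusion p q Co k ∧ Pr k ⊆ X}

theorem derived_mono : Monotone (derived p q Pr Co) := by
  rintro X Y h s (h1 | h1 | ⟨k, h1, h2⟩)
  · exact .inl h1
  · exact .inr (.inl (h h1))
  · exact .inr (.inr ⟨k, h1, h2.trans h⟩)

/-- Closure under derivations. -/
def closure : ClosureOperator (Set (Fin N)) :=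
  .ofCompletePred (fun X => derived p q Pr Co X ⊆ X) fun _ hS =>
    Set.subset_sInter fun X hX =>
      (derived_mono p q Pr Co (Set.sInter_subset_of_mem hX)).trans (hS X hX)

theorem closure_eq_iff (X : Set (Fin N)) :
    closure p q Pr Co X = X ↔ derived p q Pr Co X ⊆ X :=
  ((closure p q Pr Co).isClosed_iff).symm

theorem mem_closure_iff (X : Set (Fin N)) (s : Fin N) :
    s ∈ closure p q Pr Co X ↔ ∀ Y, X ∪ derived p q Pr Co Y ⊆ Y → s ∈ Y := by
  constructor
  · intro h Y hY
    have hc := (closure_eq_iff p q Pr Co Y).2 (Set.subset_union_right.trans hY)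
    exact cl_subset_of hc (Set.subset_union_left.trans hY) h
  · intro h
    exact h _ (Set.union_subset (subset_cl _) ((closure_eq_iff p q Pr Co _).1 (cl_cl X)))

theorem eq_univ_of_bot_mem {X : Set (Fin N)} (hX : closure p q Pr Co X = X) (h : p ∈ X) :
    X = Set.univ :=
  Set.eq_univ_of_forall fun _ => (closure_eq_iff p q Pr Co X).1 hX (.inr (.inl h))

theorem closure_eq_of_forall {X : Set (Fin N)} (h0 : closure p q Pr Co ∅ ⊆ X)
    (hp : p ∈ X → X = Set.univ) (h : ∀ k, Pr k ⊆ X → conclusion p q Co k ⊆ X) :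
    closure p q Pr Co X = X := by
  rw [closure_eq_iff]
  rintro s (hs | hs | ⟨k, hs, hk⟩)
  · exact h0 ((closure_eq_iff p q Pr Co _).1 (cl_cl ∅) (.inl hs))
  · rw [hp hs]
    trivial
  · exact h k hk hs

theorem conclusion_subset_closure (k : Fin N) :
    conclusion p q Co k ⊆ closure p q Pr Co (Pr k) := fun _ hs =>
  (closure_eq_iff p q Pr Co _).1 (cl_cl (Pr k)) (.inr (.inr ⟨k, hs, subset_cl _⟩))

theorem locallyModular_iff (h : ∃ e, p < e) :
    LocallyModular (closure p q Pr Co) p Pr (conclusion p q Co) ↔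
      ModularClosure (closure p q Pr Co) p := by
  have hb : ∀ X, closure p q Pr Co X = X → p ∈ X → X = Set.univ :=
    fun X hX => eq_univ_of_bot_mem p q Pr Co hX
  refine ⟨fun h => h.modularClosure hb fun X => closure_eq_of_forall p q Pr Co,
    fun hM => hM.locallyModular hb (conclusion_subset_closure p q Pr Co) ?_⟩
  obtain ⟨e, he⟩ := h
  exact ⟨e, (closure_eq_iff p q Pr Co _).1 (cl_cl ∅) (.inl he)⟩

/-- One step of the generation of the smallest pair-closed set that contains the join irreducible
elements of the closures of the elements of `Pr k`. -/
def pairStep (k : Fin N) (X : Set (Fin N)) : Set (Fin N) :=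
  {s | s ∈ joinIrr (closure p q Pr Co) p ∧ ((∃ a ∈ Pr k, s ∈ closure p q Pr Co {a}) ∨
    ∃ x ∈ X, ∃ y ∈ X, s ∈ closure p q Pr Co {x, y})}

theorem pairStep_mono (k : Fin N) : Monotone (pairStep p q Pr Co k) := by
  rintro X Y h s ⟨hs, h1 | ⟨x, hx, y, hy, h1⟩⟩
  · exact ⟨hs, .inl h1⟩
  · exact ⟨hs, .inr ⟨x, h hx, y, h hy, h1⟩⟩

theorem forall_pairStep_iff (k s : Fin N) :
    (∀ X, pairStep p q Pr Co k X ⊆ X → s ∈ X) ↔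
      ∀ I, PairClosed (closure p q Pr Co) p I →
        (∀ a ∈ Pr k, joinIrr (closure p q Pr Co) p ∩ closure p q Pr Co {a} ⊆ I) → s ∈ I := by
  constructor
  · rintro h I hI hP
    refine h I ?_
    rintro r ⟨hr, ⟨a, ha, h1⟩ | ⟨x, hx, y, hy, h1⟩⟩
    · exact hP a ha ⟨hr, h1⟩
    · exact hI.2 x hx y hy ⟨hr, h1⟩
  · intro h X hX
    refine (h (X ∩ joinIrr (closure p q Pr Co) p) ⟨Set.inter_subset_right, ?_⟩ ?_).1
    · rintro x hx y hy r ⟨hr, h1⟩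
      exact ⟨hX ⟨hr, .inr ⟨x, hx.1, y, hy.1, h1⟩⟩, hr⟩
    · rintro a ha r ⟨hr, h1⟩
      exact ⟨hX ⟨hr, .inl ⟨a, ha, h1⟩⟩, hr⟩

end

/-! ### The closed sets of an input -/

theorem isModularSemilattice_closedFamily_iff {n N : ℕ} {S : Finset (Implication (Fin n))}
    {L : List (List (Fin n) × List (Fin n))}
    (hS : ∀ J, J ∈ S ↔ J ∈ L.map fun I => (I.1.toFinset, I.2.toFinset))
    (hN : N = n + L.length + 2) {p q : Fin N} (hp : (p : ℕ) = n) (hq : (q : ℕ) = L.length)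
    {Pr Co : Fin N → Set (Fin N)}
    (hPr : ∀ k e, e ∈ Pr k ↔ (e : ℕ) ∈ ((L.getD k ([], [])).1.map Fin.val))
    (hCo : ∀ k e, e ∈ Co k ↔ (e : ℕ) ∈ ((L.getD k ([], [])).2.map Fin.val)) :
    IsModularSemilattice (closedFamily S) ↔ ModularClosure (closure p q Pr Co) p := by
  have hlift : ∀ i : Fin n, (i : ℕ) < N := fun i => by omega
  -- A member of the family is represented together with the auxiliary elements above `p`.
  refine isModularSemilattice_iff
    (fun X : closedFamily S => {e : Fin N | p < e ∨ ∃ i ∈ X.1, (i : ℕ) = e}) ?_ ?_ ?_ ?_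
  · intro X Y
    constructor
    · rintro h e (he | ⟨i, hi, he⟩)
      · exact .inl he
      · exact .inr ⟨i, h hi, he⟩
    · intro h i hi
      rcases h (show (⟨i, hlift i⟩ : Fin N) ∈ _ from .inr ⟨i, hi, rfl⟩) with h1 | ⟨j, hj, h1⟩
      · rw [Fin.lt_def, hp] at h1
        exact absurd h1 (by simp only; omega)
      · rwa [← Fin.ext h1]
  · intro X
    rw [closure_eq_iff]
    rintro s (hs | (hs | ⟨i, -, hi⟩) | ⟨k, ⟨hkq, hs⟩, hk⟩)
    · exact .inl hs
    · exact absurd hs (lt_irrefl p)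
    · exact absurd i.2 (by omega)
    · rw [Fin.lt_def, hq] at hkq
      have hget : L.getD k ([], []) = L[(k : ℕ)] := List.getD_eq_getElem _ _ hkq
      have hI := X.2 _ ((hS _).2 (List.mem_map_of_mem (List.getElem_mem hkq)))
      have hsub : L[(k : ℕ)].1.toFinset ⊆ X.1 := by
        intro i hi
        have hmem : (⟨i, hlift i⟩ : Fin N) ∈ Pr k := by
          rw [hPr, hget]
          exact List.mem_map_of_mem (List.mem_toFinset.1 hi)
        rcases hk hmem with h1 | ⟨j, hj, h1⟩
        · rw [Fin.lt_def, hp] at h1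
          exact absurd h1 (by simp only; omega)
        · rwa [← Fin.ext h1]
      rcases hs with hs | ⟨-, hs⟩
      · rw [hCo, hget] at hs
        obtain ⟨i, hi, his⟩ := List.mem_map.1 hs
        exact .inr ⟨i, hI.1 ⟨i, List.mem_toFinset.2 hi⟩ hsub (List.mem_toFinset.2 hi), his⟩
      · refine absurd hsub (hI.2 (Finset.eq_empty_of_forall_notMem fun i hi => ?_))
        refine hs ⟨i, hlift i⟩ ?_
        rw [hCo, hget]
        exact List.mem_map_of_mem (List.mem_toFinset.1 hi)
  · rintro X (h | ⟨i, -, hi⟩)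
    · exact lt_irrefl p h
    · omega
  · intro Y hY hpY
    rw [closure_eq_iff] at hY
    obtain ⟨Z, hmem⟩ : ∃ Z : Finset (Fin n), ∀ {i}, i ∈ Z ↔ (⟨i, hlift i⟩ : Fin N) ∈ Y := by
      classical
      exact ⟨Finset.univ.filter fun i => (⟨i, hlift i⟩ : Fin N) ∈ Y, by simp⟩
    refine ⟨⟨Z, ?_⟩, ?_⟩
    · intro I hI
      obtain ⟨J, hJ, rfl⟩ := List.mem_map.1 ((hS _).1 hI)
      obtain ⟨k, hk, rfl⟩ := List.getElem_of_mem hJ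
      have hget : L.getD k ([], []) = L[k] := List.getD_eq_getElem _ _ hk
      have hkq : (⟨k, by omega⟩ : Fin N) < q := by rw [Fin.lt_def, hq]; exact hk
      have hder : ∀ s, s ∈ conclusion p q Co ⟨k, by omega⟩ →
          L[k].1.toFinset ⊆ Z → s ∈ Y := by
        intro s hs hA
        refine hY (.inr (.inr ⟨_, hs, fun e he => ?_⟩))
        rw [hPr, hget] at he
        obtain ⟨i, hi, hie⟩ := List.mem_map.1 he
        obtain rfl : (⟨i, hlift i⟩ : Fin N) = e := Fin.ext hie
        exact hmem.1 (hA (List.mem_toFinset.2 hi))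
      refine ⟨fun _ hA i hi => hmem.2 (hder _ ⟨hkq, .inl ?_⟩ hA), fun hB hA => ?_⟩
      · rw [hCo, hget]
        exact List.mem_map_of_mem (List.mem_toFinset.1 hi)
      · refine hpY (hder p ⟨hkq, .inr ⟨rfl, fun e he => ?_⟩⟩ hA)
        rw [hCo, hget] at he
        obtain ⟨i, hi, -⟩ := List.mem_map.1 he
        exact Finset.notMem_empty i (hB ▸ List.mem_toFinset.2 hi)
    · ext e
      constructor
      · rintro (he | ⟨i, hi, he⟩)
        · exact hY (.inl he)
        · obtain rfl : (⟨i, hlift i⟩ : Fin N) = e := Fin.ext he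
          exact hmem.1 hi
      · intro he
        rcases lt_trichotomy p e with h | rfl | h
        · exact .inl h
        · exact absurd he hpY
        · rw [Fin.lt_def, hp] at h
          exact .inr ⟨⟨e, h⟩, hmem.2 he, rfl⟩

/-! ### The decision procedure -/

namespace Form

def or (φ ψ : Form) : Form := not (and (not φ) (not ψ))

def imp (φ ψ : Form) : Form := not (and φ (not ψ))

/-- for all values of the variable `x`, `φ` -/
def all (x : ℕ) (φ : Form) : Form := not (ex x (not φ))

/-- `x = y` -/
def eq (x y : ℕ) : Form := and (not (lt x y)) (not (lt y x))

section
variable {N : ℕ} {A : ℕ → ℕ → ℕ} {ρ : ℕ → Fin N} {φ ψ : Form} {x y a : ℕ} {xs : List ℕ}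

@[simp] theorem sat_lt : Sat A ρ (lt x y) ↔ ρ x < ρ y := Iff.rfl

@[simp] theorem sat_rel : Sat A ρ (rel a xs) ↔ 0 < A a (cell (xs.map ρ)) := Iff.rfl

@[simp] theorem sat_not : Sat A ρ (not φ) ↔ ¬ Sat A ρ φ := Iff.rfl

@[simp] theorem sat_and : Sat A ρ (and φ ψ) ↔ Sat A ρ φ ∧ Sat A ρ ψ := Iff.rfl

@[simp] theorem sat_ex : Sat A ρ (ex x φ) ↔ ∃ i, Sat A (Function.update ρ x i) φ := Iff.rfl

@[simp] theorem sat_or : Sat A ρ (or φ ψ) ↔ Sat A ρ φ ∨ Sat A ρ ψ := by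
  simp [or, or_iff_not_and_not]

@[simp] theorem sat_imp : Sat A ρ (imp φ ψ) ↔ (Sat A ρ φ → Sat A ρ ψ) := by
  simp [imp]

@[simp] theorem sat_all : Sat A ρ (all x φ) ↔ ∀ i, Sat A (Function.update ρ x i) φ := by
  simp [all]

@[simp] theorem sat_eq : Sat A ρ (eq x y) ↔ ρ x = ρ y := by
  simp only [eq, sat_and, sat_not, sat_lt, not_lt]
  exact ⟨fun h => le_antisymm h.2 h.1, fun h => ⟨h.ge, h.le⟩⟩

end

/-- The variable `s` is in the set of elements that are derived in one step from the set `X`,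
where `X v d` says that the variable `v` is in this set; the variables from `d` on are free to
be bound. -/
def derivedFrom (X : ℕ → ℕ → Form) (s d : ℕ) : Form :=
  or (lt 0 s) (or (X 0 d) (ex d (and
    (and (lt d 1) (or (rel 2 [d, s]) (and (eq s 0) (all (d + 1) (not (rel 2 [d, d + 1]))))))
    (all (d + 1) (imp (rel 1 [d, d + 1]) (X (d + 1) (d + 2)))))))

theorem sat_derivedFrom {N : ℕ} {A : ℕ → ℕ → ℕ} {ρ : ℕ → Fin N} {p q : Fin N}
    {Pr Co : Fin N → Set (Fin N)} (hp : ρ 0 = p) (hq : ρ 1 = q)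
    (hPr : ∀ k e, 0 < A 1 (cell [k, e]) ↔ e ∈ Pr k)
    (hCo : ∀ k e, 0 < A 2 (cell [k, e]) ↔ e ∈ Co k) {X : ℕ → ℕ → Form} {s d : ℕ}
    (hd : 2 ≤ d) (hs : s < d) (Y : Set (Fin N))
    (hX : ∀ v d' (ρ' : ℕ → Fin N), d ≤ d' → v < d' → (∀ x < d, ρ' x = ρ x) →
      (Sat A ρ' (X v d') ↔ ρ' v ∈ Y)) :
    Sat A ρ (derivedFrom X s d) ↔ ρ s ∈ derived p q Pr Co Y := by
  have h0 : Sat A ρ (X 0 d) ↔ p ∈ Y := by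
    rw [hX 0 d ρ le_rfl (by omega) fun _ _ => rfl, hp]
  have h1 : ∀ k e, Sat A (Function.update (Function.update ρ d k) (d + 1) e) (X (d + 1) (d + 2)) ↔
      e ∈ Y := by
    intro k e
    rw [hX (d + 1) (d + 2) _ (by omega) (by omega), Function.update_self]
    intro x hx
    rw [Function.update_of_ne (by omega), Function.update_of_ne (by omega)]
  have hd0 : (0 : ℕ) ≠ d := by omega
  have hd1 : (1 : ℕ) ≠ d := by omega
  simp [derivedFrom, h0, h1, hs.ne, hd0, hd1, hPr, hCo, hp, hq, derived, conclusion,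
    Set.subset_def]

/-- Rows `t` of the array `3`: the element `s` (variable `3`) is derived from the variables
`4, …, 7` in at most `t` rounds (variable `2`). -/
def closureStage : Form :=
  or (or (or (eq 3 4) (eq 3 5)) (or (eq 3 6) (eq 3 7)))
    (derivedFrom (fun v d => ex d (and (lt d 2) (rel 3 [d, v, 4, 5, 6, 7]))) 3 8)

/-- Array `4`: the element `s` (variable `2`) is in the closure of the variables `3, …, 6`. -/
def inClosure : Form := ex 7 (rel 3 [7, 2, 3, 4, 5, 6])

/-- Array `5`: the element `e` (variable `2`) is inconsistent or join irreducible. -/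
def irreducible : Form :=
  let X : ℕ → Form := fun v => and (rel 4 [v, 2, 2, 2, 2]) (not (rel 4 [2, v, v, v, v]))
  or (eq 2 0) (all 3 (imp (derivedFrom (fun v _ => X v) 3 4) (X 3)))

/-- Rows `t` of the array `6`: the element `s` (variable `3`) is in the pair-closed set that belongs
to the implication `k` (variable `4`), after at most `t` rounds (variable `2`). -/
def pairStage : Form :=
  and (rel 5 [3]) (or (ex 5 (and (rel 1 [4, 5]) (rel 4 [3, 5, 5, 5, 5])))
    (ex 5 (and (ex 6 (and (lt 6 2) (rel 6 [6, 5, 4])))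
      (ex 6 (and (ex 7 (and (lt 7 2) (rel 6 [7, 6, 4]))) (rel 4 [3, 5, 5, 6, 6]))))))

/-- Some element is consistent. -/
def condBot : Form := ex 2 (not (rel 4 [0, 2, 2, 2, 2]))

/-- The join irreducible elements below a conclusion are generated in pairs from those below the
elements of the premise. -/
def condPairs : Form :=
  all 2 (all 3 (imp
    (and (lt 2 1) (or (rel 2 [2, 3]) (and (eq 3 0) (all 4 (not (rel 2 [2, 4]))))))
    (all 4 (imp (rel 5 [4]) (imp (rel 4 [4, 3, 3, 3, 3]) (ex 5 (rel 6 [5, 4, 2])))))))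

/-- Four pairwise consistent join irreducible elements are consistent, and the join irreducible
elements of their closure are on lines between the closures of two pairs. -/
def condJoin : Form :=
  all 2 <| imp (rel 5 [2]) <| all 3 <| imp (rel 5 [3]) <|
  all 4 <| imp (rel 5 [4]) <| all 5 <| imp (rel 5 [5]) <|
  imp (not (rel 4 [0, 2, 2, 3, 3])) <| imp (not (rel 4 [0, 2, 2, 4, 4])) <|
  imp (not (rel 4 [0, 2, 2, 5, 5])) <| imp (not (rel 4 [0, 3, 3, 4, 4])) <|
  imp (not (rel 4 [0, 3, 3, 5, 5])) <| imp (not (rel 4 [0, 4, 4, 5, 5])) <|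
  and (not (rel 4 [0, 2, 3, 4, 5])) <|
  all 6 <| imp (rel 5 [6]) <| imp (rel 4 [6, 2, 3, 4, 5]) <|
  ex 7 <| and (rel 5 [7]) <| ex 8 <| and (rel 5 [8]) <|
  and (rel 4 [7, 2, 2, 3, 3]) <| and (rel 4 [8, 4, 4, 5, 5]) <| rel 4 [6, 7, 7, 8, 8]

/-- The modular law for join irreducible elements on a line. -/
def condModular : Form :=
  all 2 <| imp (rel 5 [2]) <| all 3 <| imp (rel 5 [3]) <| all 4 <| imp (rel 5 [4]) <|
  imp (not (rel 4 [0, 2, 2, 3, 3])) <| imp (rel 4 [4, 2, 2, 3, 3]) <|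
  or (rel 4 [4, 2, 2, 2, 2]) <| ex 5 <|
  and (rel 4 [5, 3, 3, 3, 3]) <| and (rel 4 [5, 2, 2, 4, 4]) <| rel 4 [4, 2, 2, 5, 5]

/-- The conditions of `LocallyModular`. -/
def locallyModular : Form := and condBot (and condPairs (and condJoin condModular))

theorem sat_locallyModular {N : ℕ} {A : ℕ → ℕ → ℕ} {ρ : ℕ → Fin N} {p q : Fin N}
    {Pr Co : Fin N → Set (Fin N)} (hp : ρ 0 = p) (hq : ρ 1 = q)
    (hCo : ∀ k e, 0 < A 2 (cell [k, e]) ↔ e ∈ Co k)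
    (h4 : ∀ s x y z w, 0 < A 4 (cell [s, x, y, z, w]) ↔ s ∈ closure p q Pr Co {x, y, z, w})
    (h5 : ∀ e, 0 < A 5 (cell [e]) ↔ e ∈ joinIrr (closure p q Pr Co) p)
    (h6 : ∀ s k, (∃ t, 0 < A 6 (cell [t, s, k])) ↔ ∀ I, PairClosed (closure p q Pr Co) p I →
      (∀ a ∈ Pr k, joinIrr (closure p q Pr Co) p ∩ closure p q Pr Co {a} ⊆ I) → s ∈ I) :
    Sat A ρ locallyModular ↔
      LocallyModular (closure p q Pr Co) p Pr (conclusion p q Co) := by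
  have h41 : ∀ s x, 0 < A 4 (cell [s, x, x, x, x]) ↔ s ∈ closure p q Pr Co {x} := by simp [h4]
  have h42 : ∀ s x y, 0 < A 4 (cell [s, x, x, y, y]) ↔ s ∈ closure p q Pr Co {x, y} := by
    simp [h4]
  constructor <;>
  · rintro ⟨e1, e2, e3, e4⟩
    refine ⟨?_, ?_, ?_, ?_⟩
    · simpa [condBot, h41, hp] using e1
    · simpa [condPairs, h41, h5, h6, hCo, hp, hq, conclusion] using e2
    · simpa [condJoin, h42, h4, h5, hp] using e3
    · simpa [condModular, h42, h41, h4, h5, hp] using e4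

end Form

section
variable {N : ℕ} {p q : Fin N} {Pr Co : Fin N → Set (Fin N)} {σ : State}

theorem runs_closureStage (hN : 1 < N) (hσ : Params p q σ)
    (hPr : ∀ k e, 0 < σ.arr 1 (cell [k, e]) ↔ e ∈ Pr k)
    (hCo : ∀ k e, 0 < σ.arr 2 (cell [k, e]) ↔ e ∈ Co k) :
    Runs N (table 3 6 Form.closureStage) σ fun τ => Params p q τ ∧
      (∀ b ≠ 3, τ.arr b = σ.arr b) ∧ ∀ s x y z w,
        (∃ t, 0 < τ.arr 3 (cell [t, s, x, y, z, w])) ↔ s ∈ closure p q Pr Co {x, y, z, w} := by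
  have hmono : ∀ B, Monotone fun Y => B ∪ derived p q Pr Co Y := fun B Y Z h =>
    Set.union_subset_union_right _ (derived_mono p q Pr Co h)
  let Q : List (Fin N) → Prop
    | [t, s, x, y, z, w] =>
        s ∈ (fun Y => ({x, y, z, w} : Set (Fin N)) ∪ derived p q Pr Co Y)^[(t : ℕ) + 1] ∅
    | _ => False
  refine (runs_table hN (by norm_num) (by decide) Q hσ ?_).mono ?_
  · intro ρ A h0 h1 hA hrows
    change _ ↔ ρ 3 ∈ (fun Y => ({ρ 4, ρ 5, ρ 6, ρ 7} : Set (Fin N)) ∪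
      derived p q Pr Co Y)^[(ρ 2 : ℕ) + 1] ∅
    rw [Function.iterate_succ_apply', Form.closureStage, Form.sat_or,
      Form.sat_derivedFrom h0 h1 (Pr := Pr) (Co := Co) (by rwa [hA 1 (by norm_num)])
        (by rwa [hA 2 (by norm_num)]) (by norm_num) (by norm_num)
        ((fun Y => ({ρ 4, ρ 5, ρ 6, ρ 7} : Set (Fin N)) ∪ derived p q Pr Co Y)^[(ρ 2 : ℕ)] ∅)]
    · simp [or_assoc]
    · intro v d ρ' hd hv hρ'
      have hne : ∀ x < 8, x ≠ d := fun x hx => by omega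
      rw [mem_iterate_empty_iff (hmono _)]
      simp only [Form.sat_ex, Form.sat_and, Form.sat_lt, Form.sat_rel, List.map_cons,
        List.map_nil, Function.update_self, Function.update_of_ne hv.ne,
        Function.update_of_ne (hne 2 (by norm_num)), Function.update_of_ne (hne 4 (by norm_num)),
        Function.update_of_ne (hne 5 (by norm_num)), Function.update_of_ne (hne 6 (by norm_num)),
        Function.update_of_ne (hne 7 (by norm_num)), hρ' 2 (by norm_num), hρ' 4 (by norm_num),
        hρ' 5 (by norm_num), hρ' 6 (by norm_num), hρ' 7 (by norm_num)]
      constructor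
      · rintro ⟨t, ht, h⟩
        exact ⟨t, ht, (hrows t ht [_, _, _, _, _] rfl).1 h⟩
      · rintro ⟨t, ht, h⟩
        exact ⟨⟨t, by omega⟩, ht, (hrows ⟨t, by omega⟩ ht [_, _, _, _, _] rfl).2 h⟩
  · rintro τ ⟨h1, h2, h3⟩
    refine ⟨h1, h2, fun s x y z w => ?_⟩
    rw [mem_closure_iff, ← exists_mem_iterate_iff (hmono _)]
    exact exists_congr fun t => h3 [t, s, x, y, z, w] rfl

theorem runs_inClosure (hN : 1 < N) (hσ : Params p q σ)
    (h3 : ∀ s x y z w, (∃ t, 0 < σ.arr 3 (cell [t, s, x, y, z, w])) ↔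
      s ∈ closure p q Pr Co {x, y, z, w}) :
    Runs N (table 4 5 Form.inClosure) σ fun τ => Params p q τ ∧
      (∀ b ≠ 4, τ.arr b = σ.arr b) ∧ ∀ s x y z w,
        0 < τ.arr 4 (cell [s, x, y, z, w]) ↔ s ∈ closure p q Pr Co {x, y, z, w} := by
  let Q : List (Fin N) → Prop
    | [s, x, y, z, w] => s ∈ closure p q Pr Co {x, y, z, w}
    | _ => False
  refine (runs_table hN (by norm_num) (by decide) Q hσ ?_).mono ?_
  · intro ρ A h0 h1 hA _
    change _ ↔ ρ 2 ∈ closure p q Pr Co {ρ 3, ρ 4, ρ 5, ρ 6}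
    rw [← h3, ← hA 3 (by norm_num)]
    simp [Form.inClosure]
  · rintro τ ⟨h1, h2, h4⟩
    exact ⟨h1, h2, fun s x y z w => h4 [s, x, y, z, w] rfl⟩

theorem runs_irreducible (hN : 1 < N) (hσ : Params p q σ)
    (hPr : ∀ k e, 0 < σ.arr 1 (cell [k, e]) ↔ e ∈ Pr k)
    (hCo : ∀ k e, 0 < σ.arr 2 (cell [k, e]) ↔ e ∈ Co k)
    (h4 : ∀ s x y z w, 0 < σ.arr 4 (cell [s, x, y, z, w]) ↔
      s ∈ closure p q Pr Co {x, y, z, w}) :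
    Runs N (table 5 1 Form.irreducible) σ fun τ => Params p q τ ∧
      (∀ b ≠ 5, τ.arr b = σ.arr b) ∧ ∀ e,
        0 < τ.arr 5 (cell [e]) ↔ e ∈ joinIrr (closure p q Pr Co) p := by
  let Q : List (Fin N) → Prop
    | [e] => e ∈ joinIrr (closure p q Pr Co) p
    | _ => False
  refine (runs_table hN (by norm_num) (by decide) Q hσ ?_).mono ?_
  · intro ρ A h0 h1 hA _
    change _ ↔ ρ 2 ∈ joinIrr (closure p q Pr Co) p
    have hX : ∀ (v : ℕ) (ρ' : ℕ → Fin N), ρ' 2 = ρ 2 →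
        (Form.Sat A ρ' ((Form.rel 4 [v, 2, 2, 2, 2]).and (Form.rel 4 [2, v, v, v, v]).not) ↔
          ρ' v ∈ {f | f ∈ closure p q Pr Co {ρ 2} ∧ ρ 2 ∉ closure p q Pr Co {f}}) := by
      intro v ρ' h
      rw [Form.sat_and, Form.sat_not, Form.sat_rel, Form.sat_rel, hA 4 (by norm_num)]
      simp [h4, h]
    rw [Form.irreducible, Form.sat_or, Form.sat_all, joinIrr, Set.mem_ofPred_eq, Form.sat_eq, h0]
    refine or_congr_right ?_
    have hcl : ∀ Y : Set (Fin N), closure p q Pr Co Y ⊆ Y ↔ derived p q Pr Co Y ⊆ Y := fun Y => by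
      rw [← closure_eq_iff]
      exact ⟨fun h => h.antisymm (subset_cl Y), fun h => h.subset⟩
    rw [hcl]
    refine forall_congr' fun s => ?_
    rw [Form.sat_imp, hX 3 _ (by simp),
      Form.sat_derivedFrom (Pr := Pr) (Co := Co) (by simpa using h0) (by simpa using h1)
      (by rwa [hA 1 (by norm_num)]) (by rwa [hA 2 (by norm_num)]) (by norm_num) (by norm_num)
      {f | f ∈ closure p q Pr Co {ρ 2} ∧ ρ 2 ∉ closure p q Pr Co {f}}]
    · simp
    · intro v d ρ' _ _ hρ'
      exact hX v ρ' (by rw [hρ' 2 (by norm_num)]; simp)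
  · rintro τ ⟨h1, h2, h5⟩
    exact ⟨h1, h2, fun e => h5 [e] rfl⟩

theorem runs_pairStage (hN : 1 < N) (hσ : Params p q σ)
    (hPr : ∀ k e, 0 < σ.arr 1 (cell [k, e]) ↔ e ∈ Pr k)
    (h4 : ∀ s x y z w, 0 < σ.arr 4 (cell [s, x, y, z, w]) ↔
      s ∈ closure p q Pr Co {x, y, z, w})
    (h5 : ∀ e, 0 < σ.arr 5 (cell [e]) ↔ e ∈ joinIrr (closure p q Pr Co) p) :
    Runs N (table 6 3 Form.pairStage) σ fun τ => Params p q τ ∧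
      (∀ b ≠ 6, τ.arr b = σ.arr b) ∧ ∀ s k, (∃ t, 0 < τ.arr 6 (cell [t, s, k])) ↔
        ∀ I, PairClosed (closure p q Pr Co) p I →
          (∀ a ∈ Pr k, joinIrr (closure p q Pr Co) p ∩ closure p q Pr Co {a} ⊆ I) → s ∈ I := by
  let Q : List (Fin N) → Prop
    | [t, s, k] => s ∈ (pairStep p q Pr Co k)^[(t : ℕ) + 1] ∅
    | _ => False
  refine (runs_table hN (by norm_num) (by decide) Q hσ ?_).mono ?_
  · intro ρ A h0 h1 hA hrows
    change _ ↔ ρ 3 ∈ (pairStep p q Pr Co (ρ 4))^[(ρ 2 : ℕ) + 1] ∅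
    have hself : ∀ x, (∃ t < ρ 2, 0 < A 6 (cell [t, x, ρ 4])) ↔
        x ∈ (pairStep p q Pr Co (ρ 4))^[(ρ 2 : ℕ)] ∅ := by
      intro x
      rw [mem_iterate_empty_iff (pairStep_mono p q Pr Co _)]
      constructor
      · rintro ⟨t, ht, h⟩
        exact ⟨t, ht, (hrows t ht [_, _] rfl).1 h⟩
      · rintro ⟨t, ht, h⟩
        exact ⟨⟨t, by omega⟩, ht, (hrows ⟨t, by omega⟩ ht [_, _] rfl).2 h⟩
    rw [Function.iterate_succ_apply']
    rw [← hA 1 (by norm_num)] at hPr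
    rw [← hA 4 (by norm_num)] at h4
    rw [← hA 5 (by norm_num)] at h5
    have h41 : ∀ s x, 0 < A 4 (cell [s, x, x, x, x]) ↔ s ∈ closure p q Pr Co {x} := by simp [h4]
    have h42 : ∀ s x y, 0 < A 4 (cell [s, x, x, y, y]) ↔ s ∈ closure p q Pr Co {x, y} := by
      simp [h4]
    simp [Form.pairStage, pairStep, h41, h42, h5, hPr, hself, and_or_left]
  · rintro τ ⟨h1, h2, h6⟩
    refine ⟨h1, h2, fun s k => ?_⟩
    rw [← forall_pairStep_iff, ← exists_mem_iterate_iff (pairStep_mono p q Pr Co k)]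
    exact exists_congr fun t => h6 [t, s, k] rfl

end

/-- The decision procedure: it tabulates the closures of four elements, the join irreducible
elements and the pair-closed sets of the premises, evaluates the local conditions for modularity,
and puts the result into register `0`. -/
def decideModular : Program :=
  .seq setup (.seq readSystem (.seq (table 3 6 Form.closureStage) (.seq (table 4 5 Form.inClosure)
    (.seq (table 5 1 Form.irreducible) (.seq (table 6 3 Form.pairStage)
      (.seq (Form.locallyModular.code 0) (.copy 0 (tmp 0))))))))

open Classical in
theorem runs_decideModular {n : ℕ} {S : Finset (Implication (Fin n))} {w : List ℕ}
    (hw : IsInputWord w S) : Runs (n + S.card + 2) decideModular (inputState w) fun τ =>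
      τ.reg 0 = if IsModularSemilattice (closedFamily S) then 1 else 0 := by
  obtain ⟨L, hnd, hL, hS, rfl⟩ := hw
  have hcard : S.card = L.length := by
    have h : S = (L.map fun I => (I.1.toFinset, I.2.toFinset)).toFinset := by
      ext J
      rw [List.mem_toFinset, hS]
    rw [h, List.toFinset_card_of_nodup hL, List.length_map]
  rw [hcard]
  set N := n + L.length + 2 with hN
  have hN1 : 1 < N := by omega
  let p : Fin N := ⟨n, by omega⟩
  let q : Fin N := ⟨L.length, by omega⟩
  let L' : List (List ℕ × List ℕ) := L.map fun I => (I.1.map Fin.val, I.2.map Fin.val)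
  have hget : ∀ k, L'.getD k ([], []) =
      ((L.getD k ([], [])).1.map Fin.val, (L.getD k ([], [])).2.map Fin.val) := by
    intro k
    simp only [L', List.getD_eq_getElem?_getD, List.getElem?_map]
    cases L[k]? <;> rfl
  let Pr : Fin N → Set (Fin N) := fun k => {e | (e : ℕ) ∈ (L'.getD k ([], [])).1}
  let Co : Fin N → Set (Fin N) := fun k => {e | (e : ℕ) ∈ (L'.getD k ([], [])).2}
  have henc : encodeSystem L = n :: L.length :: encodeLists L' := by
    simp [encodeSystem, encodeElements, encodeLists, L', List.flatMap_map]
  have hL' : ∀ I ∈ L', (I.1.length ≤ N ∧ ∀ e ∈ I.1, e < N) ∧ I.2.length ≤ N ∧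
      ∀ e ∈ I.2, e < N := by
    have key : ∀ l : List (Fin n), l.Nodup →
        (l.map Fin.val).length ≤ N ∧ ∀ e ∈ l.map Fin.val, e < N := by
      intro l hl
      refine ⟨?_, fun e he => ?_⟩
      · have := hl.length_le_card
        rw [Fintype.card_fin] at this
        rw [List.length_map]
        omega
      · obtain ⟨i, -, rfl⟩ := List.mem_map.1 he
        omega
    intro I hI
    obtain ⟨J, hJ, rfl⟩ := List.mem_map.1 hI
    exact ⟨key _ (hnd J hJ).1, key _ (hnd J hJ).2⟩
  have hmod : IsModularSemilattice (closedFamily S) ↔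
      LocallyModular (closure p q Pr Co) p Pr (conclusion p q Co) := by
    rw [locallyModular_iff p q Pr Co ⟨⟨n + 1, by omega⟩, by simp [p, Fin.lt_def]⟩]
    refine isModularSemilattice_closedFamily_iff hS hN rfl rfl ?_ ?_
    · intro k e
      simp only [Pr, Set.mem_ofPred_eq, hget]
    · intro k e
      simp only [Co, Set.mem_ofPred_eq, hget]
  rw [henc]
  refine .seq ((runs_setup hN (p := p) (q := q) rfl rfl _).mono ?_)
  rintro σ₀ ⟨hσ₀, hpend, harr⟩
  refine .seq ((runs_readSystem hN1 hσ₀ (by simp [L', q]) hL' hpend harr).mono ?_)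
  rintro σ₁ ⟨hσ₁, hread⟩
  have hPr : ∀ k e, 0 < σ₁.arr 1 (cell [k, e]) ↔ e ∈ Pr k := fun k e => (hread k e).1
  have hCo : ∀ k e, 0 < σ₁.arr 2 (cell [k, e]) ↔ e ∈ Co k := fun k e => (hread k e).2
  refine .seq ((runs_closureStage hN1 hσ₁ hPr hCo).mono ?_)
  rintro σ₂ ⟨hσ₂, hk, h3⟩
  rw [← hk 1 (by norm_num)] at hPr
  rw [← hk 2 (by norm_num)] at hCo
  refine .seq ((runs_inClosure hN1 hσ₂ h3).mono ?_)
  rintro σ₃ ⟨hσ₃, hk, h4⟩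
  rw [← hk 1 (by norm_num)] at hPr
  rw [← hk 2 (by norm_num)] at hCo
  refine .seq ((runs_irreducible hN1 hσ₃ hPr hCo h4).mono ?_)
  rintro σ₄ ⟨hσ₄, hk, h5⟩
  rw [← hk 1 (by norm_num)] at hPr
  rw [← hk 2 (by norm_num)] at hCo
  rw [← hk 4 (by norm_num)] at h4
  refine .seq ((runs_pairStage hN1 hσ₄ hPr h4 h5).mono ?_)
  rintro σ₅ ⟨hσ₅, hk, h6⟩
  rw [← hk 2 (by norm_num)] at hCo
  rw [← hk 4 (by norm_num)] at h4
  rw [← hk 5 (by norm_num)] at h5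
  obtain ⟨ρ, h0, h1, -⟩ := exists_assignment p q []
  refine .seq ((runs_code Form.locallyModular (d := 2) (k := 0) (ρ := ρ) (by decide) hσ₅.ready
    ?_).mono ?_)
  · intro x hx
    interval_cases x
    · rw [hσ₅.fst, h0]
    · rw [hσ₅.snd, h1]
  · rintro τ ⟨-, hτ, -⟩
    refine .copy ?_
    rw [setReg_reg, if_pos rfl, hτ]
    exact if_congr ((Form.sat_locallyModular h0 h1 hCo h4 h5 h6).trans hmod.symm) rfl rfl

end RAM

theorem Polynomial.eval_le_eval_nat (p : Polynomial ℕ) {a b : ℕ} (h : a ≤ b) :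
    p.eval a ≤ p.eval b := by
  rw [Polynomial.eval_eq_sum, Polynomial.eval_eq_sum]
  exact Finset.sum_le_sum fun i _ => Nat.mul_le_mul_left _ (Nat.pow_le_pow_left h i)

theorem mainTheorem4 :
    ∃ (P : RAM.Program) (p : Polynomial ℕ),
      ∀ (n : ℕ) (S : Finset (Implication (Fin n))) (w : List ℕ), IsInputWord w S →
        ∃ (t : ℕ) (τ : RAM.State),
          RAM.Exec P (RAM.inputState w) t τ ∧
          t ≤ p.eval (n + S.card + implicationSize S) ∧
          (IsModularSemilattice (closedFamily S) → τ.reg 0 = 1) ∧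
          (¬ IsModularSemilattice (closedFamily S) → τ.reg 0 = 0) := by
  classical
  refine ⟨RAM.decideModular, RAM.decideModular.cost.comp (Polynomial.X + 2), ?_⟩
  intro n S w hw
  obtain ⟨t, τ, hrun, ht, hτ⟩ := RAM.runs_decideModular hw
  refine ⟨t, τ, hrun, ht.trans ?_, fun h => ?_, fun h => ?_⟩
  · rw [Polynomial.eval_comp]
    refine Polynomial.eval_le_eval_nat _ ?_
    simp only [Polynomial.eval_add, Polynomial.eval_X, Polynomial.eval_ofNat]
    omega
  · rw [hτ, if_pos h]
  · rw [hτ, if_neg h]
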